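/- A finite extension $F/k$ of fields is called \emph{Hopf Galois} if there is a finite-dimensional cocommutative $k$-Hopf algebra $H$ such that $F$ is an $H$-module algebra and the $k$-linear map $j:F\otimes_k H\to\operatorname{End}_k(F)$, $j(s\otimes h)(t)=s\,(h t)$, is bijective. A finite separable extension $F/k$ with Galois closure $E$, $\Gamma=\operatorname{Gal}(E/k)$ and $\Gamma'=\operatorname{Gal}(E/F)$, is called \emph{almost classically Galois} if, for the homomorphism $\lambda:\Gamma\to\operatorname{Sym}(\Gamma/\Gamma')$ given by left translation on left cosets, there is a regular (that is, simply transitive) subgroup $N$ of $\operatorname{Sym}(\Gamma/\Gamma')$ that is normalized by $\lambda(\Gamma)$ and contained in $\lambda(\Gamma)$. Let $K/k$ be a separable field extension of degree $5$ that is not Hopf Galois, let $\widetilde K/k$ be its Galois closure, and let $G=\operatorname{Gal}(\widetilde K/k)$. Then $G\cong A_5$ or $G\cong S_5$, and the smallest degree $[F:k]$ of a field $F$ with $K\subseteq F\subseteq\widetilde K$ such that $F/k$ is Hopf Galois is $60$. More precisely: 1. if $G\cong A_5$, this smallest degree is attained by $F=\widetilde K$, i.e. $\widetilde K/k$ is Hopf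 Galois and $[\widetilde K:k]=60$; 2. if $G\cong S_5$, it is attained by an almost classically Galois extension, i.e. there is a field $F$ with $K\subseteq F\subseteq\widetilde K$ and $[F:k]=60$ such that $F/k$ is Hopf Galois and almost classically Galois. -/

import Mathlib

open scoped TensorProduct

universe u v w

/-- The `k`-linear map `j : F ⊗ H → End_k(F)`, `j (s ⊗ h) t = s * (h t)`, attached to a `k`-linear
action `μ` of `H` on `F`. -/
noncomputable def hopfGaloisMap (k : Type u) (F : Type v) (H : Type w) [Field k] [Field F]
    [Algebra k F] [Ring H] [Algebra k H] (μ : H →ₐ[k] Module.End k F) :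
    F ⊗[k] H →ₗ[k] Module.End k F :=
  TensorProduct.lift ((LinearMap.mul k (Module.End k F)).compl₁₂ (LinearMap.mul k F) μ.toLinearMap)

/-- The action `μ` of the `k`-Hopf algebra `H` makes `F` an `H`-module algebra
(`h (x y) = ∑ (h₁ x) (h₂ y)` and `h 1 = ε(h) 1`), and the map `j : F ⊗ H → End_k(F)` is
bijective. -/
structure IsHopfGaloisAction (k : Type u) (F : Type v) (H : Type w) [Field k] [Field F]
    [Algebra k F] [Ring H] [HopfAlgebra k H] (μ : H →ₐ[k] Module.End k F) : Prop where
  act_mul : ∀ (h : H) (x y : F), μ h (x * y) =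
    LinearMap.mul' k F (TensorProduct.homTensorHomMap (RingHom.id k) F F F F
      (TensorProduct.map μ.toLinearMap μ.toLinearMap (Coalgebra.comul (R := k) h)) (x ⊗ₜ[k] y))
  act_one : ∀ h : H, μ h 1 = algebraMap k F (Coalgebra.counit (R := k) h)
  bijective : Function.Bijective (hopfGaloisMap k F H μ)

/-- `F/k` is a Hopf Galois extension: it is finite, and some finite cocommutative `k`-Hopf algebra
`H` acts on `F` such that `F` is an `H`-module algebra and `F ⊗ H → End_k(F)` is bijective.
(A finite-dimensional `H` is as a `k`-space isomorphic to some `k^m` and `k` embeds in `F`, so that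
the restriction to the universe of `F` is no restriction.) -/
def IsHopfGalois (k : Type u) (F : Type v) [Field k] [Field F] [Algebra k F] : Prop :=
  FiniteDimensional k F ∧
    ∃ (H : Type v) (_ : Ring H) (_ : HopfAlgebra k H) (μ : H →ₐ[k] Module.End k F),
      FiniteDimensional k H ∧ Coalgebra.IsCocomm k H ∧ IsHopfGaloisAction k F H μ

/-- A group of permutations of `X` is regular if it acts simply transitively on `X`. -/
def IsRegularPermGroup {X : Type u} (N : Subgroup (Equiv.Perm X)) : Prop :=
  ∀ x y : X, ∃! σ : Equiv.Perm X, σ ∈ N ∧ σ x = y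

/-- The subgroup `G' = Gal(E/F)` of `G = Gal(E/k)`. -/
def galSubgroup (k : Type u) (F : Type v) (E : Type w) [Field k] [Field F] [Field E]
    [Algebra k F] [Algebra k E] [Algebra F E] [IsScalarTower k F E] : Subgroup (E ≃ₐ[k] E) :=
  (IsScalarTower.toAlgHom k F E).fieldRange.fixingSubgroup

/-- `F/k` is almost classically Galois: it is finite and separable and, with `E/k` its Galois
closure (unique up to isomorphism), `G = Gal(E/k)`, `G' = Gal(E/F)` and `λ : G → Sym(G/G')` the
action by left translation on left cosets, there is a regular subgroup `N` of `Sym(G/G')` that is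
normalized by `λ(G)` and contained in `λ(G)`. -/
def IsAlmostClassicallyGalois (k : Type u) (F : Type v) [Field k] [Field F] [Algebra k F] : Prop :=
  FiniteDimensional k F ∧ Algebra.IsSeparable k F ∧
    ∃ (E : Type v) (_ : Field E) (_ : Algebra k E) (_ : Algebra F E) (_ : IsScalarTower k F E),
      IsNormalClosure k F E ∧
        ∃ N : Subgroup (Equiv.Perm ((E ≃ₐ[k] E) ⧸ galSubgroup k F E)),
          IsRegularPermGroup N ∧
          (MulAction.toPermHom (E ≃ₐ[k] E) ((E ≃ₐ[k] E) ⧸ galSubgroup k F E)).range ≤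
            Subgroup.normalizer (N : Set (Equiv.Perm ((E ≃ₐ[k] E) ⧸ galSubgroup k F E))) ∧
          N ≤ (MulAction.toPermHom (E ≃ₐ[k] E) ((E ≃ₐ[k] E) ⧸ galSubgroup k F E)).range

/-! ### Actions of `A₅` on small groups, and transitive groups of degree five -/

section GroupTheory

/-! Let `G` be the Galois group of the closure `L`, acting faithfully on the five embeddings of `K`.
Two facts about Hopf Galois extensions carry the argument, one for existence and one for
obstruction.

Existence (`isHopfGalois_of_isComplement'`): a normal complement `N` of `Gal(L/F)` in `G` makes
`F/k` Hopf Galois. The Hopf algebra is the fixed ring of `L[N]`, with `G` acting on coefficients and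
by conjugation on `N`; Galois descent gives it the right dimension. If the Sylow 5-subgroup of `G`
were normal, it would complement `Gal(L/K)`, so `K` would be Hopf Galois. Otherwise Sylow counting
leaves only `A₅` and `S₅`. The same criterion settles degree 60: the whole group complements the
trivial one for `A₅`, and `A₅` complements a transposition fixing the point of `K` for `S₅`. In the
latter case the image of the complement in `Sym(G/G')` is the regular subgroup required of an almost
classically Galois extension.

Obstruction (`IsHopfGalois.exists_regular`): if `F/k` is Hopf Galois, the group-like elements of `L
⊗ H` form a group `N` that acts simply transitively on the embeddings of `F`, compatibly with an
action of `G` on `N` by automorphisms. A field above `K` of degree below 60 other than `K` has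
degree 10, 15, 20, 30 or 40, and `A₅` acts trivially on every group of such an order
(`MonoidHom.alternatingGroup_mulAut_eq_one`). Then `A₅` commutes with the simply transitive action
of `N`, so an element fixing one embedding fixes all and is trivial. Thus `A₅` acts freely on fewer
than 60 points, which is absurd. -/

/-- A homomorphism from a noncommutative simple group to a commutative group is trivial. -/
theorem MonoidHom.eq_one_of_isSimpleGroup_of_commute {A B : Type*} [Group A] [Group B]
    [IsSimpleGroup A] (hA : ¬ ∀ a b : A, a * b = b * a) (f : A →* B)
    (hB : ∀ x y : B, x * y = y * x) : f = 1 := by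
  rcases IsSimpleGroup.eq_bot_or_eq_top_of_normal f.ker inferInstance with h | h
  · refine absurd (fun a b => ?_) hA
    apply (MonoidHom.ker_eq_bot_iff f).1 h
    rw [map_mul, map_mul, hB]
  · ext a
    have : a ∈ f.ker := h ▸ Subgroup.mem_top a
    simpa using this

theorem MonoidHom.eq_one_of_isSimpleGroup_of_map_eq_one {A B : Type*} [Group A] [Group B]
    [IsSimpleGroup A] (f : A →* B) {a : A} (ha : a ≠ 1) (h1 : f a = 1) : f = 1 := by
  rcases IsSimpleGroup.eq_bot_or_eq_top_of_normal f.ker inferInstance with h | h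
  · refine absurd ?_ ha
    apply (MonoidHom.ker_eq_bot_iff f).1 h
    rw [h1, map_one]
  · ext b
    have : b ∈ f.ker := h ▸ Subgroup.mem_top b
    simpa using this

/-- A noncommutative simple group that acts trivially on a commutative characteristic subgroup `P`
of `N` and on `N ⧸ P` acts trivially on `N`. -/
theorem MonoidHom.eq_one_of_trivial_on_subgroup_and_quotient {A N : Type*} [Group A] [Group N]
    [IsSimpleGroup A] (hA : ¬ ∀ a b : A, a * b = b * a) (φ : A →* MulAut N) (P : Subgroup N)
    (hcomm : ∀ x y : P, x * y = y * x)
    (hP : ∀ a, ∀ p ∈ P, φ a p = p) (hQ : ∀ a n, n⁻¹ * φ a n ∈ P) : φ = 1 := by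
  have key : ∀ n a, φ a n = n := by
    intro n
    -- The crossed homomorphism `a ↦ n⁻¹ φ_a(n)` is an honest homomorphism because `A` fixes `P`
    -- pointwise; its target is commutative, so it is trivial.
    let c : A →* P :=
      { toFun := fun a => ⟨n⁻¹ * φ a n, hQ a n⟩
        map_one' := by ext; simp
        map_mul' := fun a b => by
          ext
          have h := hP a _ (hQ b n)
          simp only [map_mul, map_inv, MulAut.mul_apply, Subgroup.coe_mul] at h ⊢
          rw [← h]; group }
    intro a
    have h := DFunLike.congr_fun
      (MonoidHom.eq_one_of_isSimpleGroup_of_commute hA c hcomm) a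
    have h' : n⁻¹ * φ a n = 1 := congrArg Subtype.val h
    exact (inv_mul_eq_one.1 h').symm
  ext a n
  simpa using key n a

theorem IsCyclic.mulAut_mul_comm {P : Type*} [Group P] [IsCyclic P] (x y : MulAut P) :
    x * y = y * x := by
  apply (IsCyclic.mulAutMulEquiv P).injective
  rw [map_mul, map_mul, mul_comm]

/-- The automorphism group of `N` acts on the quotient by a characteristic subgroup. -/
noncomputable def MulAut.quotientCharacteristic {N : Type*} [Group N] (P : Subgroup N) [P.Normal]
    [P.Characteristic] : MulAut N →* MulAut (N ⧸ P) where
  toFun e := QuotientGroup.congr P P e (Subgroup.characteristic_iff_map_eq.1 inferInstance e)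
  map_one' := by
    ext x; obtain ⟨x, rfl⟩ := QuotientGroup.mk_surjective x; rfl
  map_mul' a b := by
    ext x; obtain ⟨x, rfl⟩ := QuotientGroup.mk_surjective x; rfl

/-- A cyclic group has a commutative automorphism group, so `A` must act trivially on `P`; only the
action on the quotient remains to be controlled. -/
theorem MonoidHom.eq_one_of_cyclic_characteristic {A N : Type*} [Group A] [Group N]
    [IsSimpleGroup A] (hA : ¬ ∀ a b : A, a * b = b * a) (φ : A →* MulAut N) (P : Subgroup N)
    [P.Normal] [P.Characteristic] [IsCyclic P]
    (hQ : (MulAut.quotientCharacteristic P).comp φ = 1) : φ = 1 := by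
  refine MonoidHom.eq_one_of_trivial_on_subgroup_and_quotient hA φ P ?_ ?_ ?_
  · intro x y
    exact (IsCyclic.isMulCommutative (α := P)).is_comm.comm x y
  · intro a p hp
    have h := DFunLike.congr_fun (MonoidHom.eq_one_of_isSimpleGroup_of_commute hA
      ((MulAut.characteristic P).comp φ) IsCyclic.mulAut_mul_comm) a
    have h2 := DFunLike.congr_fun h (⟨p, hp⟩ : P)
    exact congrArg Subtype.val h2
  · intro a n
    have h := DFunLike.congr_fun (DFunLike.congr_fun hQ a) (n : N ⧸ P)
    have h' : ((φ a n : N) : N ⧸ P) = (n : N ⧸ P) := h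
    exact QuotientGroup.eq.1 h'.symm

/-- In a Z-group both the commutator subgroup and the abelianization are cyclic, so both layers have
commutative automorphism groups. -/
theorem MonoidHom.eq_one_of_isZGroup {A N : Type*} [Group A] [Group N] [Finite N]
    [IsSimpleGroup A] (hA : ¬ ∀ a b : A, a * b = b * a) (φ : A →* MulAut N) [IsZGroup N] :
    φ = 1 := by
  have := IsZGroup.isCyclic_commutator N
  have : IsCyclic (N ⧸ commutator N) := IsZGroup.isCyclic_abelianization (G := N)
  exact MonoidHom.eq_one_of_cyclic_characteristic hA φ (commutator N)
    (MonoidHom.eq_one_of_isSimpleGroup_of_commute hA _ IsCyclic.mulAut_mul_comm)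

/-- An automorphism of order `5` of a group of order `4` or `8` is trivial. -/
theorem MulAut.eq_one_of_pow_five {Q : Type*} [Group Q] [Finite Q]
    (hQ : Nat.card Q = 4 ∨ Nat.card Q = 8) (e : MulAut Q) (he : e ^ 5 = 1) : e = 1 := by
  have : Fact (Nat.Prime 5) := ⟨by norm_num⟩
  let Z := Subgroup.zpowers e
  have hZ : IsPGroup 5 Z := by
    rintro ⟨x, hx⟩
    obtain ⟨i, rfl⟩ := Subgroup.mem_zpowers_iff.1 hx
    refine ⟨1, ?_⟩
    ext1
    simp only [pow_one, SubmonoidClass.mk_pow]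
    rw [← zpow_natCast, ← zpow_mul, mul_comm, zpow_mul]
    norm_cast
    rw [he, one_zpow]
  have hmod := hZ.card_modEq_card_fixedPoints Q
  let S : Subgroup Q :=
    { carrier := MulAction.fixedPoints Z Q
      one_mem' := fun g => map_one (g : MulAut Q)
      mul_mem' := fun {a b} ha hb g => by
        have h1 : (g : MulAut Q) a = a := ha g
        have h2 : (g : MulAut Q) b = b := hb g
        change (g : MulAut Q) (a * b) = a * b
        rw [map_mul, h1, h2]
      inv_mem' := fun {a} ha g => by
        have h1 : (g : MulAut Q) a = a := ha g
        change (g : MulAut Q) a⁻¹ = a⁻¹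
        rw [map_inv, h1] }
  have hdvd : Nat.card S ∣ Nat.card Q := Subgroup.card_subgroup_dvd_card S
  have hmod' : Nat.card Q ≡ Nat.card S [MOD 5] := hmod
  -- The number of fixed points divides 4 or 8 and is congruent to that order modulo 5. The residues
  -- of 1, 2, 4, 8 are distinct, so everything is fixed.
  have hS : S = ⊤ := by
    apply Subgroup.eq_top_of_card_eq
    have hle := Nat.le_of_dvd Nat.card_pos hdvd
    rcases hQ with h | h <;> rw [h] at hdvd hmod' hle ⊢ <;> unfold Nat.ModEq at hmod'
    · generalize Nat.card S = s at *; interval_cases s <;> omega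
    · generalize Nat.card S = s at *; interval_cases s <;> omega
  ext q
  have : q ∈ S := hS ▸ Subgroup.mem_top q
  exact this ⟨e, Subgroup.mem_zpowers e⟩

theorem alternatingGroup_fin_five_not_comm :
    ¬ ∀ a b : alternatingGroup (Fin 5), a * b = b * a := by
  intro h
  have := (alternatingGroup.isMulCommutative_iff_card_le_three (α := Fin 5)).1 ⟨⟨h⟩⟩
  simp at this

/-- The Sylow 5-subgroup is normal and cyclic, with quotient of order 4 or 8. An element of order 5
of `A` acts trivially on that quotient, hence so does the simple group `A`. -/
theorem MonoidHom.eq_one_of_card_quotient {A N : Type*} [Group A] [Group N] [Finite N]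
    [Finite A] [IsSimpleGroup A] (hA : ¬ ∀ a b : A, a * b = b * a) (h5 : 5 ∣ Nat.card A)
    (φ : A →* MulAut N) (hN : Nat.card N = 20 ∨ Nat.card N = 40) : φ = 1 := by
  have : Fact (Nat.Prime 5) := ⟨by norm_num⟩
  obtain ⟨P⟩ : Nonempty (Sylow 5 N) := inferInstance
  have hP : Nat.card P = 5 := by
    rw [P.card_eq_multiplicity]
    rcases hN with h | h <;> rw [h]
    · rw [show 20 = 5 ^ 1 * 4 by norm_num, Nat.factorization_mul (by norm_num) (by norm_num)]
      simp [Nat.factorization_eq_zero_of_not_dvd (show ¬ 5 ∣ 4 by norm_num),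
        Nat.Prime.factorization_self (show Nat.Prime 5 by norm_num)]
    · rw [show 40 = 5 ^ 1 * 8 by norm_num, Nat.factorization_mul (by norm_num) (by norm_num)]
      simp [Nat.factorization_eq_zero_of_not_dvd (show ¬ 5 ∣ 8 by norm_num),
        Nat.Prime.factorization_self (show Nat.Prime 5 by norm_num)]
  have hidx : (P : Subgroup N).index = 4 ∨ (P : Subgroup N).index = 8 := by
    have := Subgroup.card_mul_index (P : Subgroup N)
    have hP' : Nat.card (P : Subgroup N) = 5 := hP
    rw [hP'] at this
    omega
  have : Subsingleton (Sylow 5 N) := by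
    have h1 := card_sylow_modEq_one 5 N
    have h2 := P.card_dvd_index
    rw [← Finite.card_le_one_iff_subsingleton]
    have hle := Nat.le_of_dvd (by omega) h2
    unfold Nat.ModEq at h1
    generalize Nat.card (Sylow 5 N) = s at *
    have : s ≤ 8 := by omega
    rcases hidx with h | h <;> rw [h] at h2 hle <;> interval_cases s <;> omega
  have := P.normal_of_subsingleton
  have := P.characteristic_of_subsingleton
  have : IsCyclic (P : Subgroup N) := isCyclic_of_prime_card hP
  refine MonoidHom.eq_one_of_cyclic_characteristic hA φ (P : Subgroup N) ?_
  obtain ⟨a, ha⟩ := exists_prime_orderOf_dvd_card' 5 h5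
  refine MonoidHom.eq_one_of_isSimpleGroup_of_map_eq_one _ (a := a) ?_ ?_
  · rintro rfl; simp at ha
  · refine MulAut.eq_one_of_pow_five ?_ _ ?_
    · exact hidx
    · have ha5 : a ^ 5 = 1 := by rw [← ha, pow_orderOf_eq_one]
      rw [← map_pow, ha5, map_one]

theorem nat_card_alternatingGroup_fin_five : Nat.card (alternatingGroup (Fin 5)) = 60 := by
  rw [nat_card_alternatingGroup]; simp [Nat.factorial]

/-- `A₅` acts trivially on every group whose order is one of `10, 15, 20, 30, 40`. -/
theorem MonoidHom.alternatingGroup_mulAut_eq_one {N : Type*} [Group N] [Finite N]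
    (φ : alternatingGroup (Fin 5) →* MulAut N)
    (hN : Nat.card N ∈ ({10, 15, 20, 30, 40} : Set ℕ)) : φ = 1 := by
  have hA := alternatingGroup_fin_five_not_comm
  have h5 : 5 ∣ Nat.card (alternatingGroup (Fin 5)) := by
    rw [nat_card_alternatingGroup_fin_five]; norm_num
  simp only [Set.mem_insert_iff, Set.mem_singleton_iff] at hN
  have hsq : Nat.card N = 10 ∨ Nat.card N = 15 ∨ Nat.card N = 30 → φ = 1 := by
    intro h
    have : IsZGroup N := by
      apply IsZGroup.of_squarefree
      rcases h with h | h | h <;> rw [h] <;> decide +kernel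
    exact MonoidHom.eq_one_of_isZGroup hA φ
  rcases hN with h | h | h | h | h
  · exact hsq (.inl h)
  · exact hsq (.inr (.inl h))
  · exact MonoidHom.eq_one_of_card_quotient hA h5 φ (.inl h)
  · exact hsq (.inr (.inr h))
  · exact MonoidHom.eq_one_of_card_quotient hA h5 φ (.inr h)

/-- A subgroup of `S₅` of order divisible by `30` contains `A₅`. -/
theorem Subgroup.alternatingGroup_le_of_thirty_dvd_card (T : Subgroup (Equiv.Perm (Fin 5)))
    (h30 : 30 ∣ Nat.card T) : alternatingGroup (Fin 5) ≤ T := by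
  have h120 : Nat.card (Equiv.Perm (Fin 5)) = 120 := by
    rw [Nat.card_perm]; simp [Nat.factorial]
  have hidx := T.card_mul_index
  rw [h120] at hidx
  have hdvd : T.index ∣ 4 := by
    obtain ⟨m, hm⟩ := h30
    rw [hm] at hidx
    exact ⟨m, by nlinarith⟩
  -- There are at most 4 cosets, and `60 > 4!`, so the simple group `A₅` acts trivially on them and
  -- fixes the coset of the identity.
  let f : alternatingGroup (Fin 5) →* Equiv.Perm (Equiv.Perm (Fin 5) ⧸ T) :=
    (MulAction.toPermHom (Equiv.Perm (Fin 5)) (Equiv.Perm (Fin 5) ⧸ T)).comp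
      (alternatingGroup (Fin 5)).subtype
  have hf : f.ker = ⊤ := by
    rcases IsSimpleGroup.eq_bot_or_eq_top_of_normal f.ker inferInstance with h | h
    · have hle := Nat.card_le_card_of_injective f ((MonoidHom.ker_eq_bot_iff f).1 h)
      rw [nat_card_alternatingGroup_fin_five, Nat.card_perm] at hle
      have h4 : T.index ≤ 4 := Nat.le_of_dvd (by norm_num) hdvd
      have := Nat.factorial_le h4
      rw [Subgroup.index] at this
      simp [Nat.factorial] at this hle
      omega
    · exact h
  intro a ha
  have h1 : f ⟨a, ha⟩ = 1 := (MonoidHom.mem_ker).1 (hf ▸ Subgroup.mem_top _)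
  have h2 : a • ((1 : Equiv.Perm (Fin 5)) : Equiv.Perm (Fin 5) ⧸ T) =
      ((1 : Equiv.Perm (Fin 5)) : Equiv.Perm (Fin 5) ⧸ T) :=
    DFunLike.congr_fun h1 ((1 : Equiv.Perm (Fin 5)) : Equiv.Perm (Fin 5) ⧸ T)
  have h3 := QuotientGroup.eq.1 h2.symm
  simpa using h3

theorem card_dvd_of_injective_perm_fin_five {G : Type*} [Group G]
    (f : G →* Equiv.Perm (Fin 5)) (hf : Function.Injective f) : Nat.card G ∣ 120 := by
  have := Subgroup.card_dvd_of_injective f hf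
  rw [Nat.card_perm] at this
  simpa [Nat.factorial] using this

/-- A group of permutations of five letters whose order is divisible by `5` is `A₅`, or `S₅`, or
its Sylow `5`-subgroup, which has order `5`, is normal. -/
theorem alternating_or_symmetric_or_normal_sylow {G : Type*} [Group G]
    (f : G →* Equiv.Perm (Fin 5)) (hf : Function.Injective f) (h5 : 5 ∣ Nat.card G) :
    Nonempty (G ≃* alternatingGroup (Fin 5)) ∨ Function.Bijective f ∨
      ∃ P : Subgroup G, P.Normal ∧ Nat.card P = 5 := by
  have : Finite G := Finite.of_injective f hf
  have : Fact (Nat.Prime 5) := ⟨by norm_num⟩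
  have h120 := card_dvd_of_injective_perm_fin_five f hf
  obtain ⟨m, hm⟩ := h5
  have hm24 : m ∣ 24 := by
    rw [hm, show 120 = 5 * 24 by norm_num] at h120
    exact Nat.dvd_of_mul_dvd_mul_left (by norm_num) h120
  have hm5 : ¬ 5 ∣ m := fun h => by have := h.trans hm24; omega
  have hm0 : m ≠ 0 := by rintro rfl; simp at hm24
  obtain ⟨P⟩ : Nonempty (Sylow 5 G) := inferInstance
  have hP : Nat.card (P : Subgroup G) = 5 := by
    have h := P.card_eq_multiplicity
    rw [hm, Nat.factorization_mul (by norm_num) hm0] at h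
    simpa [Nat.factorization_eq_zero_of_not_dvd hm5,
      Nat.Prime.factorization_self (show Nat.Prime 5 by norm_num)] using h
  have hidx : (P : Subgroup G).index = m := by
    have := Subgroup.card_mul_index (P : Subgroup G)
    rw [hP, hm] at this
    omega
  by_cases hone : Nat.card (Sylow 5 G) = 1
  · have : Subsingleton (Sylow 5 G) := Finite.card_le_one_iff_subsingleton.1 hone.le
    exact .inr (.inr ⟨P, P.normal_of_subsingleton, hP⟩)
  have h6 : 30 ∣ Nat.card G := by
    have h1 := card_sylow_modEq_one 5 G
    have h2 := P.card_dvd_index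
    rw [hidx] at h2
    have h24 := h2.trans hm24
    have hle := Nat.le_of_dvd (by norm_num) h24
    -- The only divisors of 24 congruent to 1 modulo 5 are 1 and 6.
    have h66 : Nat.card (Sylow 5 G) = 6 := by
      unfold Nat.ModEq at h1
      generalize Nat.card (Sylow 5 G) = s at *
      clear h2 hidx hP P
      interval_cases s <;> omega
    rw [h66] at h2
    rw [hm]
    exact Nat.mul_dvd_mul_left 5 h2
  let e : G ≃* f.range := MonoidHom.ofInjective hf
  have hT := f.range.alternatingGroup_le_of_thirty_dvd_card (by
    rwa [← Nat.card_congr e.toEquiv])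
  by_cases htop : f.range = ⊤
  · exact .inr (.inl ⟨hf, MonoidHom.range_eq_top.1 htop⟩)
  · left
    have h2 : f.range.index = 2 := by
      have h3 := Subgroup.index_dvd_of_le hT
      rw [alternatingGroup.index_eq_two] at h3
      rcases (Nat.dvd_prime Nat.prime_two).1 h3 with h | h
      · exact absurd (Subgroup.index_eq_one.1 h) htop
      · exact h
    rw [← Equiv.Perm.eq_alternatingGroup_of_index_eq_two h2]
    exact ⟨e⟩

end GroupTheory

/-! ### From a Hopf Galois structure to a simply transitive group of group-like elements -/

section HopfGaloisDescent

open TensorProduct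

variable {k : Type*} {F : Type*} {L : Type*} {H : Type*} [Field k] [Field F] [Field L]
  [Algebra k F] [Algebra k L] [Ring H]

/-- The right translate of a `k`-linear map `f : F → L` by elements of `L ⊗ H`, for an action of
`H` on `F`: it sends `e ⊗ h` to `e • (f ∘ h)`. -/
noncomputable def rightTranslate [Algebra k H] (μ : H →ₐ[k] Module.End k F) (f : F →ₗ[k] L) :
    L ⊗[k] H →ₗ[L] (F →ₗ[k] L) :=
  LinearMap.liftBaseChange L ((LinearMap.llcomp k F F L f).comp μ.toLinearMap)

section Algebra

variable [Algebra k H] (μ : H →ₐ[k] Module.End k F)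

@[simp]
theorem rightTranslate_tmul (f : F →ₗ[k] L) (e : L) (h : H) (t : F) :
    rightTranslate μ f (e ⊗ₜ h) t = e * f (μ h t) := by
  simp [rightTranslate]

theorem comp_rightTranslate (σ : L →ₐ[k] L) (f : F →ₗ[k] L) (u : L ⊗[k] H) :
    σ.toLinearMap.comp (rightTranslate μ f u) =
      rightTranslate μ (σ.toLinearMap.comp f) (Algebra.TensorProduct.map σ (AlgHom.id k H) u) := by
  induction u with
  | zero => simp
  | add x y hx hy => simp only [map_add, LinearMap.comp_add, hx, hy]
  | tmul e h => ext t; simp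

/-- Surjectivity of `j` puts every `x ∘ T` with `T ∈ End_k(F)` in the image, and these span
`Hom_k(F, L)` over `L`. -/
theorem rightTranslate_surjective [FiniteDimensional k F]
    (hμ : Function.Surjective (hopfGaloisMap k F H μ)) (x : F →ₐ[k] L) :
    Function.Surjective (rightTranslate μ x.toLinearMap) := by
  rw [← LinearMap.range_eq_top]
  set R := LinearMap.range (rightTranslate μ x.toLinearMap) with hR
  have h1 : ∀ T : Module.End k F, x.toLinearMap.comp T ∈ R := by
    intro T
    obtain ⟨z, rfl⟩ := hμ T
    induction z with
    | zero => rw [map_zero, LinearMap.comp_zero]; exact R.zero_mem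
    | add a b ha hb => rw [map_add, LinearMap.comp_add]; exact R.add_mem ha hb
    | tmul s h =>
      refine ⟨x s ⊗ₜ h, ?_⟩
      ext t
      simp [hopfGaloisMap]
  rw [eq_top_iff]
  intro f _
  let b := Module.finBasis k F
  -- Expand `f` in the dual basis, each coordinate form being viewed as an endomorphism of `F` with
  -- values in `k · 1`.
  have h2 : f = ∑ i, f (b i) • x.toLinearMap.comp ((b.coord i).smulRight (1 : F)) := by
    refine b.ext fun j => ?_
    simp [Finsupp.single_apply, apply_ite]
  rw [h2]
  exact R.sum_mem fun i _ => R.smul_mem _ (h1 _)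

/-- Comparing dimensions across `j` gives `dim H = dim F`, so surjectivity already implies
injectivity. -/
theorem rightTranslate_bijective [FiniteDimensional k F] [FiniteDimensional k H]
    (hμ : Function.Bijective (hopfGaloisMap k F H μ)) (x : F →ₐ[k] L) :
    Function.Bijective (rightTranslate μ x.toLinearMap) := by
  have hs := rightTranslate_surjective μ hμ.2 x
  refine ⟨?_, hs⟩
  have h1 : Module.finrank k F * Module.finrank k H =
      Module.finrank k F * Module.finrank k F := by
    rw [← Module.finrank_tensorProduct, ← Module.finrank_linearMap]
    exact (LinearEquiv.ofBijective _ hμ).finrank_eq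
  have h2 : Module.finrank k H = Module.finrank k F :=
    Nat.eq_of_mul_eq_mul_left Module.finrank_pos h1
  have h3 : Module.finrank L (L ⊗[k] H) = Module.finrank L (F →ₗ[k] L) := by
    rw [Module.finrank_baseChange, Module.finrank_linearMap_self, h2]
  exact (LinearMap.injective_iff_surjective_of_finrank_eq_finrank h3).2 hs

end Algebra

/-- The product of two injective linear maps to spaces of functions, as a map from the tensor
product to functions of two variables, is injective. -/
theorem TensorProduct.eq_zero_of_forall_mul_eq_zero {V W X Y : Type*} [AddCommGroup V]
    [AddCommGroup W] [Module L V] [Module L W] (α : V →ₗ[L] (X → L)) (β : W →ₗ[L] (Y → L))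
    (hα : Function.Injective α) (hβ : Function.Injective β) (z : V ⊗[L] W)
    (hz : ∀ a b, LinearMap.mul' L L
      (TensorProduct.map ((LinearMap.proj a).comp α) ((LinearMap.proj b).comp β) z) = 0) :
    z = 0 := by
  classical
  let b := Module.Basis.ofVectorSpace L W
  let e := TensorProduct.equivFinsuppOfBasisRight (M := V) b
  obtain ⟨v, rfl⟩ := e.symm.surjective z
  suffices h : ∀ i, v i = 0 by
    rw [show v = 0 from Finsupp.ext h, map_zero]
  intro i
  apply hα
  rw [map_zero]
  funext a
  have h1 : ∑ i ∈ v.support, α (v i) a • b i = 0 := by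
    apply hβ
    rw [map_zero]
    funext c
    have h2 := hz a c
    simp only [e, TensorProduct.equivFinsuppOfBasisRight_symm_apply, Finsupp.sum, map_sum,
      TensorProduct.map_tmul, LinearMap.mul'_apply] at h2
    simpa using h2
  by_cases hi : i ∈ v.support
  · exact linearIndependent_iff'.1 b.linearIndependent v.support _ h1 i hi
  · rw [Finsupp.notMem_support_iff.1 hi, map_zero]

variable [HopfAlgebra k H] {μ : H →ₐ[k] Module.End k F}

theorem rightTranslate_apply_one (hμ : IsHopfGaloisAction k F H μ) (x : F →ₐ[k] L)
    (u : L ⊗[k] H) :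
    rightTranslate μ x.toLinearMap u 1 = Coalgebra.counit (R := L) u := by
  induction u with
  | zero => simp
  | add y z hy hz => simp only [map_add, LinearMap.add_apply, hy, hz]
  | tmul e h =>
    simp [hμ.act_one, Algebra.smul_def, mul_comm]

theorem rightTranslate_apply_mul (hμ : IsHopfGaloisAction k F H μ) (x : F →ₐ[k] L)
    (u : L ⊗[k] H) (a b : F) :
    rightTranslate μ x.toLinearMap u (a * b) = LinearMap.mul' L L
      (TensorProduct.map ((LinearMap.applyₗ' L a).comp (rightTranslate μ x.toLinearMap))
        ((LinearMap.applyₗ' L b).comp (rightTranslate μ x.toLinearMap))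
        (Coalgebra.comul (R := L) u)) := by
  induction u with
  | zero => simp
  | add y z hy hz => simp only [map_add, LinearMap.add_apply, hy, hz]
  | tmul e h =>
    rw [rightTranslate_tmul, hμ.act_mul, TensorProduct.comul_tmul]
    simp only [CommSemiring.comul_apply]
    generalize (Coalgebra.comul (R := k) h) = z
    induction z with
    | zero => simp
    | add y z hy hz =>
      simp only [map_add, LinearMap.add_apply, TensorProduct.tmul_add, mul_add, hy, hz]
    | tmul h₁ h₂ => simp [mul_left_comm]

/-- The module algebra axioms turn the counit and comultiplication of `u` into the values of its
translate at `1` and at products. For the converse, `Δu - u ⊗ u` vanishes under all pairs of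
evaluations, and these separate points because translation is injective. -/
theorem isGroupLikeElem_iff_exists_algHom [FiniteDimensional k F] [FiniteDimensional k H]
    (hμ : IsHopfGaloisAction k F H μ) (x : F →ₐ[k] L) (u : L ⊗[k] H) :
    IsGroupLikeElem L u ↔
      ∃ y : F →ₐ[k] L, y.toLinearMap = rightTranslate μ x.toLinearMap u := by
  constructor
  · intro hu
    refine ⟨AlgHom.ofLinearMap (rightTranslate μ x.toLinearMap u) ?_ ?_, rfl⟩
    · rw [rightTranslate_apply_one hμ, hu.counit_eq_one]
    · intro a b
      rw [rightTranslate_apply_mul hμ, hu.comul_eq_tmul_self]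
      simp
  · rintro ⟨y, hy⟩
    refine ⟨by rw [← rightTranslate_apply_one hμ x, ← hy]; simp, ?_⟩
    rw [← sub_eq_zero]
    have hinj := (rightTranslate_bijective μ hμ.bijective x).1
    let α : L ⊗[k] H →ₗ[L] (F → L) :=
      LinearMap.pi fun a => (LinearMap.applyₗ' L a).comp (rightTranslate μ x.toLinearMap)
    have hα : Function.Injective α := by
      intro v w h
      apply hinj
      ext a
      exact congrFun h a
    refine TensorProduct.eq_zero_of_forall_mul_eq_zero α α hα hα _ fun a b => ?_
    have hc : ∀ c, (LinearMap.proj c).comp α =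
      (LinearMap.applyₗ' L c).comp (rightTranslate μ x.toLinearMap) := fun c => rfl
    rw [map_sub, map_sub, hc, hc, ← rightTranslate_apply_mul hμ, ← hy]
    simp [← hy]

/-- Semilinear extension of an automorphism of `L` to `L ⊗ H` preserves group-like elements. -/
theorem isGroupLikeElem_map_algEquiv [FiniteDimensional k F] [FiniteDimensional k H]
    (hμ : IsHopfGaloisAction k F H μ) (x : F →ₐ[k] L) (σ : L ≃ₐ[k] L) {u : L ⊗[k] H}
    (hu : IsGroupLikeElem L u) :
    IsGroupLikeElem L (Algebra.TensorProduct.map (σ : L →ₐ[k] L) (AlgHom.id k H) u) := by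
  obtain ⟨y, hy⟩ := (isGroupLikeElem_iff_exists_algHom hμ x u).1 hu
  refine (isGroupLikeElem_iff_exists_algHom hμ ((σ : L →ₐ[k] L).comp x) _).2
    ⟨(σ : L →ₐ[k] L).comp y, ?_⟩
  rw [AlgHom.comp_toLinearMap, AlgHom.comp_toLinearMap, hy, comp_rightTranslate]

/-- The action of `Gal(L/k)` on the group-like elements of `L ⊗ H`. -/
noncomputable def galGroupLike [FiniteDimensional k F] [FiniteDimensional k H]
    (hμ : IsHopfGaloisAction k F H μ) (x : F →ₐ[k] L) :
    (L ≃ₐ[k] L) →* MulAut (GroupLike L (L ⊗[k] H)) where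
  toFun σ :=
    { toFun := fun u => ⟨_, isGroupLikeElem_map_algEquiv hμ x σ u.2⟩
      invFun := fun u => ⟨_, isGroupLikeElem_map_algEquiv hμ x σ.symm u.2⟩
      left_inv := fun u => by
        ext1
        change Algebra.TensorProduct.map _ _ (Algebra.TensorProduct.map _ _ u.1) = u.1
        rw [← AlgHom.comp_apply, ← Algebra.TensorProduct.map_comp]
        simp
      right_inv := fun u => by
        ext1
        change Algebra.TensorProduct.map _ _ (Algebra.TensorProduct.map _ _ u.1) = u.1
        rw [← AlgHom.comp_apply, ← Algebra.TensorProduct.map_comp]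
        simp
      map_mul' := fun u v => by
        ext1
        exact map_mul (Algebra.TensorProduct.map (σ : L →ₐ[k] L) (AlgHom.id k H)) u.1 v.1 }
  map_one' := by
    ext u
    change Algebra.TensorProduct.map _ _ u.1 = u.1
    exact DFunLike.congr_fun (Algebra.TensorProduct.map_id) u.1
  map_mul' σ τ := by
    ext u
    change Algebra.TensorProduct.map _ _ u.1 =
      Algebra.TensorProduct.map _ _ (Algebra.TensorProduct.map _ _ u.1)
    rw [← AlgHom.comp_apply, ← Algebra.TensorProduct.map_comp]
    rfl

/-- A Hopf Galois extension gives a group `N` acting simply transitively on the embeddings into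
`L`, compatibly with an action of `Gal(L/k)` on `N`. -/
theorem IsHopfGalois.exists_regular {k : Type*} {F : Type v} {L : Type v} [Field k] [Field F]
    [Field L] [Algebra k F] [Algebra k L] (h : IsHopfGalois k F) (x₀ : F →ₐ[k] L) :
    ∃ (N : Type v) (_ : Group N) (φ : (L ≃ₐ[k] L) →* MulAut N)
      (act : (F →ₐ[k] L) → N → (F →ₐ[k] L)),
      Nat.card N = Nat.card (F →ₐ[k] L) ∧ (∀ x y, ∃ u, act x u = y) ∧
      ∀ (σ : L ≃ₐ[k] L) x u, (σ : L →ₐ[k] L).comp (act x u) =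
        act ((σ : L →ₐ[k] L).comp x) (φ σ u) := by
  obtain ⟨hF, H, _, _, μ, hH, -, hμ⟩ := h
  have hex := fun (x : F →ₐ[k] L) (u : GroupLike L (L ⊗[k] H)) =>
    (isGroupLikeElem_iff_exists_algHom hμ x u.1).1 u.2
  choose act hact using hex
  have hreg : ∀ x y, ∃ u, act x u = y := by
    intro x y
    obtain ⟨u, hu⟩ := (rightTranslate_bijective μ hμ.bijective x).2 y.toLinearMap
    refine ⟨⟨u, (isGroupLikeElem_iff_exists_algHom hμ x u).2 ⟨y, hu.symm⟩⟩, ?_⟩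
    apply AlgHom.toLinearMap_injective
    exact (hact _ _).trans hu
  refine ⟨GroupLike L (L ⊗[k] H), inferInstance, galGroupLike hμ x₀, act, ?_, hreg, ?_⟩
  · refine Nat.card_congr (Equiv.ofBijective (act x₀) ⟨fun u v huv => ?_, hreg x₀⟩)
    ext1
    apply (rightTranslate_bijective μ hμ.bijective x₀).1
    rw [← hact, ← hact, huv]
  · intro σ x u
    apply AlgHom.toLinearMap_injective
    rw [AlgHom.comp_toLinearMap, hact, hact, comp_rightTranslate]
    rfl

/-- If `A₅` embeds in `Gal(L/k)` and `F/k` is a Hopf Galois extension such that the conjugates of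
`F` generate `L`, then `[F : k]` is none of `10, 15, 20, 30, 40`. -/
theorem not_isHopfGalois_of_alternatingGroup {k : Type*} {F : Type v} {L : Type v} [Field k]
    [Field F] [Field L] [Algebra k F] [Algebra k L]
    (hfaith : ∀ σ : L ≃ₐ[k] L, (∀ x : F →ₐ[k] L, (σ : L →ₐ[k] L).comp x = x) → σ = 1)
    (f : alternatingGroup (Fin 5) →* (L ≃ₐ[k] L)) (hf : Function.Injective f)
    (hcard : Nat.card (F →ₐ[k] L) ∈ ({10, 15, 20, 30, 40} : Set ℕ)) : ¬ IsHopfGalois k F := by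
  intro h
  have hpos : 0 < Nat.card (F →ₐ[k] L) ∧ Nat.card (F →ₐ[k] L) < 60 := by
    simp only [Set.mem_insert_iff, Set.mem_singleton_iff] at hcard
    omega
  have hfin : Finite (F →ₐ[k] L) := Nat.finite_of_card_ne_zero hpos.1.ne'
  obtain ⟨x₀⟩ : Nonempty (F →ₐ[k] L) := Nat.card_pos_iff.1 hpos.1 |>.1
  obtain ⟨N, _, φ, act, hN, hreg, hcomp⟩ := h.exists_regular x₀
  have : Finite N := Nat.finite_of_card_ne_zero (hN ▸ hpos.1.ne')
  have htriv := MonoidHom.alternatingGroup_mulAut_eq_one (φ.comp f) (hN ▸ hcard)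
  -- There are fewer than 60 embeddings; the rest shows that the orbit map of `A₅` at `x₀` would
  -- nevertheless be injective.
  have hninj : ¬ Function.Injective
      fun a : alternatingGroup (Fin 5) => ((f a : L ≃ₐ[k] L) : L →ₐ[k] L).comp x₀ := by
    intro hinj
    have := Nat.card_le_card_of_injective _ hinj
    rw [nat_card_alternatingGroup_fin_five] at this
    omega
  apply hninj
  intro a b hab
  have h1 : f (b⁻¹ * a) = 1 := by
    have hx₀ : ((f (b⁻¹ * a) : L ≃ₐ[k] L) : L →ₐ[k] L).comp x₀ = x₀ := by
      ext t
      have hab' : f a (x₀ t) = f b (x₀ t) := DFunLike.congr_fun hab t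
      change f (b⁻¹ * a) (x₀ t) = x₀ t
      rw [map_mul, AlgEquiv.mul_apply, hab', ← AlgEquiv.mul_apply, ← map_mul, inv_mul_cancel,
        map_one, AlgEquiv.one_apply]
    -- Every embedding is `act x₀ u`, and `A₅` fixes `u`; an element fixing `x₀` therefore fixes
    -- every embedding.
    apply hfaith
    intro x
    obtain ⟨u, rfl⟩ := hreg x₀ x
    rw [hcomp, hx₀]
    have := DFunLike.congr_fun (DFunLike.congr_fun htriv (b⁻¹ * a)) u
    exact congrArg _ this
  have h2 := hf (h1.trans (map_one f).symm)
  exact (inv_mul_eq_one.1 h2).symm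

end HopfGaloisDescent

/-! ### Tensors as functions of two variables -/

section TensorEval

open TensorProduct

variable {k L S T V W : Type*} [Field k] [Field L] [Algebra k L] [AddCommGroup V] [Module k V]
  [AddCommGroup W] [Module k W]

/-- The function `(s, t) ↦ α v s * β w t` attached to `v ⊗ w`. -/
noncomputable def tensorEval (α : V →ₗ[k] (S → L)) (β : W →ₗ[k] (T → L)) :
    V ⊗[k] W →ₗ[k] (S × T → L) :=
  LinearMap.pi fun p => (LinearMap.mul' k L).comp
    (TensorProduct.map ((LinearMap.proj p.1).comp α) ((LinearMap.proj p.2).comp β))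

@[simp]
theorem tensorEval_tmul (α : V →ₗ[k] (S → L)) (β : W →ₗ[k] (T → L)) (v : V) (w : W) (p : S × T) :
    tensorEval α β (v ⊗ₜ w) p = α v p.1 * β w p.2 := by
  simp [tensorEval]

end TensorEval

/-! ### Galois descent for functions on a finite Galois set -/

section EquivariantFunctions

open TensorProduct

variable (k : Type*) (L : Type*) (S T : Type*) [Field k] [Field L] [Algebra k L]
  [MulAction (L ≃ₐ[k] L) S] [MulAction (L ≃ₐ[k] L) T]

/-- The `Gal(L/k)`-equivariant functions from a `Gal(L/k)`-set `S` to `L`. -/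
def equivariantFunctions : Submodule k (S → L) where
  carrier := {f | ∀ (g : L ≃ₐ[k] L) s, f (g • s) = g (f s)}
  add_mem' hf hf' g s := by simp [hf g s, hf' g s]
  zero_mem' g s := by simp
  smul_mem' c f hf g s := by simp [hf g s]

variable {k L S T}

/-- Galois descent: the equivariant functions span all functions. -/
theorem span_equivariantFunctions [FiniteDimensional k L] [Finite S] :
    Submodule.span L (equivariantFunctions k L S : Set (S → L)) = ⊤ := by
  classical
  have := Fintype.ofFinite S
  by_contra hne
  obtain ⟨φ, hφ, hle⟩ := Submodule.exists_le_ker_of_lt_top _ (lt_top_iff_ne_top.2 hne)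
  apply hφ
  have hli : LinearIndependent L (fun g : L ≃ₐ[k] L => (g : L → L)) :=
    (linearIndependent_monoidHom L L).comp (fun g : L ≃ₐ[k] L => (g : L →* L)) fun g g' h => by
      ext x; exact DFunLike.congr_fun h x
  ext s
  -- Averaging `e • δ_s` over the Galois group yields equivariant functions. A functional killing
  -- all of them gives a linear relation among automorphisms, which independence of characters
  -- forbids.
  have hmem : ∀ e : L, (∑ g : L ≃ₐ[k] L, Pi.single (g • s) (g e) : S → L) ∈
      equivariantFunctions k L S := by
    intro e h t
    rw [Finset.sum_apply, Finset.sum_apply, map_sum,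
      ← Equiv.sum_comp (Equiv.mulLeft h)]
    refine Finset.sum_congr rfl fun g _ => ?_
    simp only [Equiv.coe_mulLeft, mul_smul, Pi.single_apply, smul_left_cancel_iff,
      AlgEquiv.mul_apply]
    split_ifs <;> simp
  have hsum : ∑ g : L ≃ₐ[k] L, φ (Pi.single (g • s) 1) • (g : L → L) = 0 := by
    funext e
    have h := LinearMap.mem_ker.1 (hle (Submodule.subset_span (hmem e)))
    rw [map_sum] at h
    rw [Finset.sum_apply, Pi.zero_apply, ← h]
    refine Finset.sum_congr rfl fun g _ => ?_
    rw [← mul_one (g e), ← smul_eq_mul (g e) (1 : L), Pi.single_smul', map_smul]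
    simp [mul_comm]
  have h1 := Fintype.linearIndependent_iff.1 hli _ hsum 1
  simpa using h1

/-- The space of equivariant functions on `S` has a `k`-basis that is an `L`-basis of the space of
all functions on `S`. -/
theorem exists_basis_equivariantFunctions [FiniteDimensional k L] [IsGalois k L] [Finite S] :
    ∃ (n : ℕ) (b : Module.Basis (Fin n) k (equivariantFunctions k L S)), n = Nat.card S ∧
      LinearIndependent L fun i => (b i : S → L) := by
  classical
  have hspan : ⊤ ≤ Submodule.span L (equivariantFunctions k L S : Set (S → L)) :=
    span_equivariantFunctions.ge
  let b₀ := Module.Basis.ofSpan hspan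
  have hfin := Module.Finite.finite_basis b₀
  have hcard : Module.finrank L (S → L) = Nat.card S := by
    have := Fintype.ofFinite S
    rw [Module.finrank_fintype_fun_eq_card, Nat.card_eq_fintype_card]
  let b := b₀.reindex (Finite.equivFin _)
  have hb : ∀ i, b i ∈ equivariantFunctions k L S := fun i => by
    apply Module.Basis.ofSpan_subset hspan
    rw [Module.Basis.reindex_apply]
    exact ⟨_, rfl⟩
  have hliL : LinearIndependent L fun i => b i := b.linearIndependent
  -- Applying `g` to the coordinates of an equivariant function gives another expansion of it, so by
  -- uniqueness the coordinates are Galois-fixed.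
  have hfix : ∀ f ∈ equivariantFunctions k L S, ∀ i, ∃ c : k, algebraMap k L c = b.repr f i := by
    intro f hf i
    apply (IsGalois.mem_range_algebraMap_iff_fixed _).2
    intro g
    have h1 : f = ∑ i, g (b.repr f i) • b i := by
      funext s
      have h2 : f (g⁻¹ • s) = ∑ i, b.repr f i * b i (g⁻¹ • s) := by
        conv_lhs => rw [← b.sum_repr f]
        simp
      have h3 := congrArg g h2
      rw [← hf g, smul_inv_smul, map_sum] at h3
      rw [h3, Finset.sum_apply]
      refine Finset.sum_congr rfl fun i _ => ?_
      rw [map_mul, ← hb i g, smul_inv_smul]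
      rfl
    conv_rhs => rw [h1]
    rw [b.repr_sum_self]
  let v : Fin _ → equivariantFunctions k L S := fun i => ⟨b i, hb i⟩
  have hli : LinearIndependent k v := by
    apply LinearIndependent.of_comp (equivariantFunctions k L S).subtype
    exact hliL.restrict_scalars' k
  have hsp : ⊤ ≤ Submodule.span k (Set.range v) := by
    rintro ⟨f, hf⟩ -
    choose c hc using hfix f hf
    have : (⟨f, hf⟩ : equivariantFunctions k L S) = ∑ i, c i • v i := by
      apply Subtype.ext
      simp only [Submodule.coe_sum, Submodule.coe_smul, v]
      conv_lhs => rw [← b.sum_repr f]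
      refine Finset.sum_congr rfl fun i _ => ?_
      rw [← hc, algebraMap_smul]
    rw [this]
    exact Submodule.sum_mem _ fun i _ =>
      Submodule.smul_mem _ _ (Submodule.subset_span ⟨i, rfl⟩)
  refine ⟨_, Module.Basis.mk hli hsp, ?_, ?_⟩
  · rw [← hcard, Module.finrank_eq_card_basis b, Fintype.card_fin]
  · have heq : (fun i => (Module.Basis.mk hli hsp i : S → L)) = fun i => b i := by
      funext i
      rw [Module.Basis.mk_apply]
    rw [heq]
    exact hliL

variable {V W : Type*} [AddCommGroup V] [Module k V] [AddCommGroup W] [Module k W]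

/-- `α` identifies `V` with the space of equivariant functions on `S`. -/
structure IsEquivariantModel (α : V →ₗ[k] (S → L)) : Prop where
  injective : Function.Injective α
  range_eq : LinearMap.range α = equivariantFunctions k L S

theorem IsEquivariantModel.apply_smul {α : V →ₗ[k] (S → L)} (h : IsEquivariantModel α) (v : V)
    (g : L ≃ₐ[k] L) (s : S) : α v (g • s) = g (α v s) :=
  (h.range_eq ▸ LinearMap.mem_range_self α v : α v ∈ equivariantFunctions k L S) g s

theorem IsEquivariantModel.exists_basis [FiniteDimensional k L] [IsGalois k L] [Finite S]
    {α : V →ₗ[k] (S → L)} (h : IsEquivariantModel α) :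
    ∃ (n : ℕ) (b : Module.Basis (Fin n) k V), n = Nat.card S ∧
      LinearIndependent L fun i => α (b i) := by
  obtain ⟨n, b, hn, hb⟩ := exists_basis_equivariantFunctions (k := k) (L := L) (S := S)
  let e : V ≃ₗ[k] equivariantFunctions k L S :=
    (LinearEquiv.ofInjective α h.injective).trans (LinearEquiv.ofEq _ _ h.range_eq)
  refine ⟨n, b.map e.symm, hn, ?_⟩
  have he : ∀ x, α (e.symm x) = x := fun x => by
    conv_rhs => rw [← e.apply_symm_apply x]
    rfl
  simpa [he] using hb

/-- Independence over `L` of the two descended bases, used one variable at a time, gives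
injectivity; a dimension count then identifies the image. This allows identities in tensor powers of
`H` to be checked pointwise. -/
theorem IsEquivariantModel.tensorEval [FiniteDimensional k L] [IsGalois k L] [Finite S] [Finite T]
    {α : V →ₗ[k] (S → L)} {β : W →ₗ[k] (T → L)} (hα : IsEquivariantModel α)
    (hβ : IsEquivariantModel β) : IsEquivariantModel (tensorEval α β) := by
  obtain ⟨n, b, hn, hb⟩ := hα.exists_basis
  obtain ⟨m, c, hm, hc⟩ := hβ.exists_basis
  have hinj : Function.Injective (_root_.tensorEval α β) := by
    rw [injective_iff_map_eq_zero]
    intro z hz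
    have hrepr := (b.tensorProduct c).sum_repr z
    set a := (b.tensorProduct c).repr z with ha
    have hval : ∀ s t, ∑ i, ∑ j, algebraMap k L (a (i, j)) * (α (b i) s * β (c j) t) = 0 := by
      intro s t
      have h := congrFun hz (s, t)
      rw [← hrepr, map_sum, Finset.sum_apply, Fintype.sum_prod_type] at h
      simpa [Algebra.smul_def] using h
    have h1 : ∀ t i, ∑ j, algebraMap k L (a (i, j)) * β (c j) t = 0 := by
      intro t
      apply Fintype.linearIndependent_iff.1 hb
      funext s
      rw [Finset.sum_apply, Pi.zero_apply, ← hval s t]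
      refine Finset.sum_congr rfl fun i _ => ?_
      simp only [Pi.smul_apply, smul_eq_mul, Finset.sum_mul]
      exact Finset.sum_congr rfl fun j _ => by ring
    have h2 : ∀ i j, algebraMap k L (a (i, j)) = 0 := by
      intro i
      apply Fintype.linearIndependent_iff.1 hc
      funext t
      rw [Finset.sum_apply, Pi.zero_apply, ← h1 t i]
      rfl
    apply (b.tensorProduct c).repr.injective
    rw [map_zero]
    ext ⟨i, j⟩
    exact (map_eq_zero _).1 (h2 i j)
  refine ⟨hinj, ?_⟩
  have hle : LinearMap.range (_root_.tensorEval α β) ≤ equivariantFunctions k L (S × T) := by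
    rintro _ ⟨z, rfl⟩ g ⟨s, t⟩
    induction z with
    | zero => simp
    | add x y hx hy => simp only [map_add, Pi.add_apply, hx, hy]
    | tmul v w =>
      simp only [Prod.smul_mk, tensorEval_tmul, map_mul, hα.apply_smul, hβ.apply_smul]
  obtain ⟨l, d, hl, -⟩ := exists_basis_equivariantFunctions (k := k) (L := L) (S := S × T)
  have := Module.Basis.finiteDimensional_of_finite d
  refine Submodule.eq_of_le_of_finrank_eq hle ?_
  rw [LinearMap.finrank_range_of_inj hinj, Module.finrank_eq_card_basis d,
    Module.finrank_eq_card_basis (b.tensorProduct c), hl]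
  simp [hn, hm]

end EquivariantFunctions

/-! ### The Hopf algebra of equivariant functions under convolution -/

section ConvolutionModel

open TensorProduct

/-- A linear map with values in the range of an injective linear map `α` factors through `α`. -/
noncomputable def LinearMap.factorThrough {R U V W : Type*} [Ring R] [AddCommGroup U]
    [AddCommGroup V] [AddCommGroup W] [Module R U] [Module R V] [Module R W] (α : V →ₗ[R] W)
    (hα : Function.Injective α) (f : U →ₗ[R] W) (hf : ∀ u, f u ∈ LinearMap.range α) : U →ₗ[R] V :=
  (LinearEquiv.ofInjective α hα).symm.toLinearMap.comp (f.codRestrict _ hf)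

theorem LinearMap.apply_factorThrough {R U V W : Type*} [Ring R] [AddCommGroup U]
    [AddCommGroup V] [AddCommGroup W] [Module R U] [Module R V] [Module R W] (α : V →ₗ[R] W)
    (hα : Function.Injective α) (f : U →ₗ[R] W) (hf : ∀ u, f u ∈ LinearMap.range α) (u : U) :
    α (LinearMap.factorThrough α hα f hf u) = f u :=
  congrArg Subtype.val ((LinearEquiv.ofInjective α hα).apply_symm_apply (f.codRestrict _ hf u))

variable {k L N H : Type*} [Field k] [Field L] [Algebra k L] [Ring H] [Algebra k H]

/-- The `k`-linear map `f ↦ ((n, m) ↦ δ_{n,m} f(n))`. -/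
noncomputable def IsConvolutionModel.diagonal [DecidableEq N] (α : H →ₗ[k] (N → L)) :
    H →ₗ[k] (N × N → L) :=
  LinearMap.pi fun p => if p.1 = p.2 then (LinearMap.proj p.1).comp α else 0

theorem IsConvolutionModel.diagonal_apply [DecidableEq N] (α : H →ₗ[k] (N → L)) (x : H) (n m : N) :
    diagonal α x (n, m) = if n = m then α x n else 0 := by
  simp only [diagonal, LinearMap.pi_apply]
  split_ifs <;> rfl

theorem tensorEval_assoc (α : H →ₗ[k] (N → L)) (z : H ⊗[k] H) (x : H) (a b c : N) :
    tensorEval α (tensorEval α α) (TensorProduct.assoc k H H H (z ⊗ₜ x)) (a, b, c) =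
      tensorEval α α z (a, b) * α x c := by
  induction z with
  | zero => simp
  | add x y hx hy => simp only [add_tmul, map_add, Pi.add_apply, hx, hy, add_mul]
  | tmul y z => simp [mul_assoc]

variable [Group N] [Fintype N] [DecidableEq N] [MulDistribMulAction (L ≃ₐ[k] L) N]

/-- `α` identifies the algebra `H` with the algebra of equivariant functions on the group `N`
under convolution. -/
structure IsConvolutionModel (α : H →ₗ[k] (N → L)) : Prop extends IsEquivariantModel α where
  map_mul : ∀ x y n, α (x * y) n = ∑ m, α x m * α y (m⁻¹ * n)
  map_one : ∀ n, α 1 n = if n = 1 then 1 else 0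

namespace IsConvolutionModel

variable {α : H →ₗ[k] (N → L)} (hα : IsConvolutionModel α)

include hα in
theorem apply_algebraMap (c : k) (n : N) :
    α (algebraMap k H c) n = if n = 1 then algebraMap k L c else 0 := by
  rw [Algebra.algebraMap_eq_smul_one, map_smul, Pi.smul_apply, hα.map_one, Algebra.smul_def]
  simp

include hα in
theorem tensorEval_mul (z w : H ⊗[k] H) (n m : N) :
    tensorEval α α (z * w) (n, m) =
      ∑ p, ∑ q, tensorEval α α z (p, q) * tensorEval α α w (p⁻¹ * n, q⁻¹ * m) := by
  induction z with
  | zero => simp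
  | add x y hx hy => simp only [add_mul, map_add, Pi.add_apply, hx, hy, Finset.sum_add_distrib]
  | tmul a b =>
    induction w with
    | zero => simp
    | add x y hx hy => simp only [mul_add, map_add, Pi.add_apply, hx, hy, Finset.sum_add_distrib]
    | tmul c d =>
      simp only [Algebra.TensorProduct.tmul_mul_tmul, tensorEval_tmul, hα.map_mul,
        Finset.sum_mul_sum]
      exact Finset.sum_congr rfl fun p _ => Finset.sum_congr rfl fun q _ => by ring

include hα in
theorem inv_mem (x : H) : (LinearMap.funLeft k L (fun n : N => n⁻¹)).comp α x ∈
    LinearMap.range α := by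
  rw [hα.range_eq]
  intro g n
  simp only [LinearMap.comp_apply, LinearMap.funLeft_apply, ← hα.apply_smul, smul_inv']

/-- The antipode of `H`. -/
noncomputable def antipode : H →ₗ[k] H :=
  LinearMap.factorThrough α hα.injective ((LinearMap.funLeft k L (fun n : N => n⁻¹)).comp α)
    hα.inv_mem

theorem apply_antipode (x : H) (n : N) : α (hα.antipode x) n = α x n⁻¹ := by
  rw [antipode, LinearMap.apply_factorThrough]
  rfl

theorem apply_mul'_rTensor_antipode (z : H ⊗[k] H) (n : N) :
    α (LinearMap.mul' k H (hα.antipode.rTensor H z)) n =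
      ∑ m, tensorEval α α z (m⁻¹, m⁻¹ * n) := by
  induction z with
  | zero => simp
  | add x y hx hy => simp only [map_add, Pi.add_apply, hx, hy, Finset.sum_add_distrib]
  | tmul x y => simp [hα.map_mul, apply_antipode]

theorem apply_mul'_lTensor_antipode (z : H ⊗[k] H) (n : N) :
    α (LinearMap.mul' k H (hα.antipode.lTensor H z)) n =
      ∑ m, tensorEval α α z (m, (m⁻¹ * n)⁻¹) := by
  induction z with
  | zero => simp
  | add x y hx hy => simp only [map_add, Pi.add_apply, hx, hy, Finset.sum_add_distrib]
  | tmul x y => simp [hα.map_mul, apply_antipode]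

variable [FiniteDimensional k L] [IsGalois k L]

include hα in
-- The diagonal of `N × N` is Galois-stable, so extension by zero from it preserves equivariance.
theorem diagonal_mem (x : H) : diagonal α x ∈ LinearMap.range (tensorEval α α) := by
  rw [(hα.toIsEquivariantModel.tensorEval hα.toIsEquivariantModel).range_eq]
  rintro g ⟨n, m⟩
  rw [Prod.smul_mk, diagonal_apply, diagonal_apply]
  by_cases h : n = m
  · simpa [h] using hα.apply_smul x g m
  · simp [h]

include hα in
-- The Galois group only permutes the summands, so their sum lies in `k`.
theorem sum_mem (x : H) :
    (∑ n, (LinearMap.proj n).comp α : H →ₗ[k] L) x ∈ LinearMap.range (Algebra.linearMap k L) := by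
  have h : (∑ n, (LinearMap.proj n).comp α : H →ₗ[k] L) x ∈ Set.range (algebraMap k L) := by
    apply (IsGalois.mem_range_algebraMap_iff_fixed _).2
    intro g
    simp only [LinearMap.sum_apply, LinearMap.comp_apply, LinearMap.proj_apply, map_sum,
      ← hα.apply_smul]
    exact Equiv.sum_comp (MulAction.toPerm g) (α x)
  exact h

/-- The comultiplication on `H`. -/
noncomputable def comul : H →ₗ[k] H ⊗[k] H :=
  LinearMap.factorThrough (tensorEval α α)
    (hα.toIsEquivariantModel.tensorEval hα.toIsEquivariantModel).injective (diagonal α)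
    hα.diagonal_mem

/-- The counit of `H`. -/
noncomputable def counit : H →ₗ[k] k :=
  LinearMap.factorThrough (Algebra.linearMap k L) (algebraMap k L).injective
    (∑ n, (LinearMap.proj n).comp α) hα.sum_mem

theorem tensorEval_comul (x : H) (n m : N) :
    tensorEval α α (hα.comul x) (n, m) = if n = m then α x n else 0 := by
  rw [comul, LinearMap.apply_factorThrough, diagonal_apply]

theorem algebraMap_counit (x : H) : algebraMap k L (hα.counit x) = ∑ n, α x n := by
  have := LinearMap.apply_factorThrough (Algebra.linearMap k L) (algebraMap k L).injective
    (∑ n, (LinearMap.proj n).comp α) hα.sum_mem x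
  rw [Algebra.linearMap_apply] at this
  rw [counit, this]
  simp

include hα in
theorem tensorEval_ext {z w : H ⊗[k] H}
    (h : ∀ n m, tensorEval α α z (n, m) = tensorEval α α w (n, m)) : z = w :=
  (hα.toIsEquivariantModel.tensorEval hα.toIsEquivariantModel).injective
    (funext fun p => h p.1 p.2)

theorem tensorEval_lTensor_comul (z : H ⊗[k] H) (a b c : N) :
    tensorEval α (tensorEval α α) (hα.comul.lTensor H z) (a, b, c) =
      if b = c then tensorEval α α z (a, b) else 0 := by
  induction z with
  | zero => simp
  | add x y hx hy =>
    simp only [map_add, Pi.add_apply, hx, hy]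
    split_ifs <;> simp
  | tmul x y => simp [tensorEval_comul]

theorem tensorEval_assoc_rTensor_comul (z : H ⊗[k] H) (a b c : N) :
    tensorEval α (tensorEval α α) (TensorProduct.assoc k H H H (hα.comul.rTensor H z)) (a, b, c) =
      if a = b then tensorEval α α z (a, c) else 0 := by
  induction z with
  | zero => simp
  | add x y hx hy =>
    simp only [map_add, Pi.add_apply, hx, hy]
    split_ifs <;> simp
  | tmul x y => simp [tensorEval_assoc, tensorEval_comul]

theorem apply_lid_rTensor_counit (z : H ⊗[k] H) (c : N) :
    α (TensorProduct.lid k H (hα.counit.rTensor H z)) c = ∑ a, tensorEval α α z (a, c) := by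
  induction z with
  | zero => simp
  | add x y hx hy => simp only [map_add, Pi.add_apply, hx, hy, Finset.sum_add_distrib]
  | tmul x y =>
    rw [LinearMap.rTensor_tmul, TensorProduct.lid_tmul, _root_.map_smul, Pi.smul_apply,
      Algebra.smul_def, algebraMap_counit, Finset.sum_mul]
    simp

theorem apply_rid_lTensor_counit (z : H ⊗[k] H) (a : N) :
    α (TensorProduct.rid k H (hα.counit.lTensor H z)) a = ∑ c, tensorEval α α z (a, c) := by
  induction z with
  | zero => simp
  | add x y hx hy => simp only [map_add, Pi.add_apply, hx, hy, Finset.sum_add_distrib]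
  | tmul x y =>
    rw [LinearMap.lTensor_tmul, TensorProduct.rid_tmul, _root_.map_smul, Pi.smul_apply,
      Algebra.smul_def, algebraMap_counit, mul_comm, Finset.mul_sum]
    simp

/-- The coalgebra structure on an algebra of equivariant functions. -/
@[reducible]
noncomputable def coalgebra : Coalgebra k H where
  comul := hα.comul
  counit := hα.counit
  coassoc := by
    ext x
    apply (hα.toIsEquivariantModel.tensorEval
      (hα.toIsEquivariantModel.tensorEval hα.toIsEquivariantModel)).injective
    funext ⟨a, b, c⟩
    simp only [LinearMap.comp_apply, LinearEquiv.coe_coe, tensorEval_assoc_rTensor_comul,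
      tensorEval_lTensor_comul, tensorEval_comul]
    by_cases h1 : a = b
    · subst h1; simp
    · simp [h1]
  rTensor_counit_comp_comul := by
    ext x
    apply (TensorProduct.lid k H).injective
    apply hα.injective
    funext c
    simp [apply_lid_rTensor_counit, tensorEval_comul]
  lTensor_counit_comp_comul := by
    ext x
    apply (TensorProduct.rid k H).injective
    apply hα.injective
    funext c
    simp [apply_rid_lTensor_counit, tensorEval_comul]

/-- The bialgebra structure on an algebra of equivariant functions. -/
@[reducible]
noncomputable def bialgebra : Bialgebra k H :=
  letI := hα.coalgebra
  Bialgebra.mk' k H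
    (by
      apply (algebraMap k L).injective
      change algebraMap k L (hα.counit 1) = _
      rw [algebraMap_counit]
      simp [hα.map_one])
    (by
      intro x y
      apply (algebraMap k L).injective
      change algebraMap k L (hα.counit _) = algebraMap k L (hα.counit _ * hα.counit _)
      simp only [_root_.map_mul, algebraMap_counit, hα.map_mul]
      rw [Finset.sum_comm, Finset.sum_mul]
      refine Finset.sum_congr rfl fun m _ => ?_
      rw [← Finset.mul_sum, ← Equiv.sum_comp (Equiv.mulLeft m⁻¹) (α y)]
      rfl)
    (by
      change hα.comul 1 = 1
      apply hα.tensorEval_ext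
      intro n m
      rw [tensorEval_comul, Algebra.TensorProduct.one_def, tensorEval_tmul, hα.map_one,
        hα.map_one]
      by_cases h1 : n = 1
      · subst h1; simp [eq_comm]
      · simp [h1])
    (by
      intro x y
      change hα.comul _ = hα.comul _ * hα.comul _
      apply hα.tensorEval_ext
      intro n m
      simp only [tensorEval_mul hα, tensorEval_comul, hα.map_mul]
      by_cases h1 : n = m
      · subst h1; simp
      · rw [if_neg h1]
        -- For `p ≠ q` the first factor is off the diagonal; for `p = q` the second is, since `n ≠
        -- m`.
        refine (Finset.sum_eq_zero fun p _ => Finset.sum_eq_zero fun q _ => ?_).symm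
        by_cases h2 : p = q
        · subst h2; simp [h1]
        · simp [h2])

/-- The Hopf algebra structure on an algebra of equivariant functions. -/
@[reducible]
noncomputable def hopfAlgebra : HopfAlgebra k H where
  __ := hα.bialgebra
  antipode := hα.antipode
  mul_antipode_rTensor_comul := by
    ext x
    apply hα.injective
    funext n
    change α (LinearMap.mul' k H (hα.antipode.rTensor H (hα.comul x))) n =
      α (algebraMap k H (hα.counit x)) n
    rw [apply_mul'_rTensor_antipode, hα.apply_algebraMap, algebraMap_counit]
    simp only [tensorEval_comul]
    by_cases h1 : n = 1
    · subst h1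
      simpa using Equiv.sum_comp (Equiv.inv N) (α x)
    · simp [h1]
  mul_antipode_lTensor_comul := by
    ext x
    apply hα.injective
    funext n
    change α (LinearMap.mul' k H (hα.antipode.lTensor H (hα.comul x))) n =
      α (algebraMap k H (hα.counit x)) n
    rw [apply_mul'_lTensor_antipode, hα.apply_algebraMap, algebraMap_counit]
    simp only [tensorEval_comul]
    by_cases h1 : n = 1
    · subst h1
      simp
    · simp [h1]

theorem isCocomm : @Coalgebra.IsCocomm k H _ _ _ hα.coalgebra := by
  let := hα.coalgebra
  refine ⟨?_⟩
  ext x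
  apply hα.tensorEval_ext
  intro n m
  have hcomm : ∀ z : H ⊗[k] H, tensorEval α α (TensorProduct.comm k H H z) (n, m) =
      tensorEval α α z (m, n) := by
    intro z
    induction z with
    | zero => simp
    | add x y hx hy => simp only [map_add, Pi.add_apply, hx, hy]
    | tmul x y => simp [mul_comm]
  change tensorEval α α (TensorProduct.comm k H H (hα.comul x)) (n, m) =
    tensorEval α α (hα.comul x) (n, m)
  rw [hcomm, tensorEval_comul, tensorEval_comul]
  by_cases h1 : n = m
  · subst h1; rfl
  · simp [h1, Ne.symm h1]

end IsConvolutionModel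

end ConvolutionModel

/-! ### The equivariant part of the group algebra `L[N]` -/

section NormalComplement

open TensorProduct

theorem MonoidAlgebra.coeff_one {R M : Type*} [Semiring R] [MulOneClass M] [DecidableEq M]
    (m : M) : (1 : MonoidAlgebra R M).coeff m = if m = 1 then 1 else 0 := by
  rw [MonoidAlgebra.one_def, MonoidAlgebra.coeff_single, Finsupp.single_apply]
  simp only [eq_comm]

variable {k L N : Type*} [Field k] [Field L] [Algebra k L] [Group N]
  [MulDistribMulAction (L ≃ₐ[k] L) N]

variable (k L N) in
/-- The equivariant elements of the group algebra `L[N]`, for a group `N` with an action of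
`Gal(L/k)`. -/
noncomputable def equivariantGroupAlgebra [Fintype N] : Subalgebra k (MonoidAlgebra L N) where
  carrier := {f | ∀ (g : L ≃ₐ[k] L) n, f.coeff (g • n) = g (f.coeff n)}
  add_mem' hf hf' g n := by simp [hf g n, hf' g n]
  mul_mem' {f f'} hf hf' g n := by
    have hf₁ : ∀ (g : L ≃ₐ[k] L) n, f.coeff (g • n) = g (f.coeff n) := hf
    have hf₂ : ∀ (g : L ≃ₐ[k] L) n, f'.coeff (g • n) = g (f'.coeff n) := hf'
    rw [MonoidAlgebra.coeff_mul_apply_left, MonoidAlgebra.coeff_mul_apply_left,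
      Finsupp.sum_fintype _ _ (by simp), Finsupp.sum_fintype _ _ (by simp), map_sum,
      ← Equiv.sum_comp (MulAction.toPerm g)]
    refine Finset.sum_congr rfl fun m _ => ?_
    rw [map_mul g, ← hf₁, ← hf₂, MulAction.toPerm_apply, smul_mul', smul_inv']
  algebraMap_mem' c g n := by
    classical
    have h : g • n = 1 ↔ n = 1 :=
      ⟨fun h => smul_left_cancel g (h.trans (smul_one g).symm), fun h => by rw [h, smul_one]⟩
    rw [Algebra.algebraMap_eq_smul_one, MonoidAlgebra.coeff_smul_apply,
      MonoidAlgebra.coeff_smul_apply, map_smul g, MonoidAlgebra.coeff_one,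
      MonoidAlgebra.coeff_one]
    simp only [h]
    split_ifs <;> simp

/-- The coefficients of an equivariant element of `L[N]`. -/
noncomputable def equivariantGroupAlgebra.coeff [Fintype N] :
    equivariantGroupAlgebra k L N →ₗ[k] (N → L) where
  toFun f n := f.1.coeff n
  map_add' _ _ := rfl
  map_smul' _ _ := rfl

theorem equivariantGroupAlgebra.isConvolutionModel [Fintype N] [DecidableEq N] :
    IsConvolutionModel (equivariantGroupAlgebra.coeff (k := k) (L := L) (N := N)) where
  injective f f' h := by
    ext n
    exact congrFun h n
  range_eq := by
    refine le_antisymm ?_ ?_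
    · rintro _ ⟨f, rfl⟩
      exact f.2
    · intro f hf
      exact ⟨⟨MonoidAlgebra.ofCoeff (Finsupp.equivFunOnFinite.symm f), hf⟩, rfl⟩
  map_mul x y n := by
    change (x.1 * y.1).coeff n = _
    rw [MonoidAlgebra.coeff_mul_apply_left, Finsupp.sum_fintype _ _ (by simp)]
    rfl
  map_one n := by
    exact MonoidAlgebra.coeff_one n

end NormalComplement

/-! ### The action on an intermediate field, and normal complements -/

section ConvolutionAction

open TensorProduct

variable {k L H : Type*} [Field k] [Field L] [Algebra k L] [Ring H] [Algebra k H]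
  {N : Subgroup (L ≃ₐ[k] L)} [Fintype N] [DecidableEq N] [MulDistribMulAction (L ≃ₐ[k] L) N]

/-- The `k`-linear endomorphism `t ↦ ∑ h(n) n⁻¹(t)` of `L`. -/
noncomputable def convolutionAction (α : H →ₗ[k] (N → L)) (x : H) : L →ₗ[k] L :=
  ∑ n : N, (LinearMap.mulLeft k (α x n)).comp ((n : L ≃ₐ[k] L)⁻¹).toLinearMap

omit [DecidableEq N] [MulDistribMulAction (L ≃ₐ[k] L) N] in
theorem convolutionAction_apply (α : H →ₗ[k] (N → L)) (x : H) (t : L) :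
    convolutionAction α x t = ∑ n : N, α x n * (n : L ≃ₐ[k] L)⁻¹ t := by
  simp [convolutionAction]

variable {α : H →ₗ[k] (N → L)}

/-- Moving `n⁻¹` past a coefficient of `y` conjugates its argument by equivariance. Reindexing by
conjugation restores the convolution product; the inverses in the action put the factors in the
right order. -/
theorem convolutionAction_mul (hα : IsConvolutionModel α)
    (hconj : ∀ (g : L ≃ₐ[k] L) (n : N), ((g • n : N) : L ≃ₐ[k] L) = g * n * g⁻¹) (x y : H) (t : L) :
    convolutionAction α (x * y) t = convolutionAction α x (convolutionAction α y t) := by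
  rw [convolutionAction_apply α (x * y), convolutionAction_apply α x, convolutionAction_apply α y]
  simp only [hα.map_mul, map_sum, map_mul, Finset.sum_mul, Finset.mul_sum]
  rw [Finset.sum_comm]
  refine Finset.sum_congr rfl fun n _ => ?_
  rw [← Equiv.sum_comp (Equiv.mulLeft n),
    ← Equiv.sum_comp (MulAction.toPerm (n : L ≃ₐ[k] L)) (fun m => α x n *
      ((n : L ≃ₐ[k] L)⁻¹ (α y m) * (n : L ≃ₐ[k] L)⁻¹ ((m : L ≃ₐ[k] L)⁻¹ t)))]
  refine Finset.sum_congr rfl fun m _ => ?_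
  rw [← hα.apply_smul]
  simp only [Equiv.coe_mulLeft, inv_mul_cancel_left, MulAction.toPerm_apply, inv_smul_smul,
    hconj, Subgroup.coe_mul, ← AlgEquiv.mul_apply, mul_assoc, mul_inv_rev, inv_inv]

theorem convolutionAction_one (hα : IsConvolutionModel α) (t : L) :
    convolutionAction α (1 : H) t = t := by
  simp only [convolutionAction_apply, hα.map_one, ite_mul, one_mul, zero_mul,
    Finset.sum_ite_eq', Finset.mem_univ, if_true, Subgroup.coe_one, inv_one, AlgEquiv.one_apply]

omit [DecidableEq N] in
-- For `g` fixing `F`, applying `g` to the sum merely conjugates the summation index, so the value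
-- is again fixed.
theorem convolutionAction_mem (hα : IsEquivariantModel α)
    (hconj : ∀ (g : L ≃ₐ[k] L) (n : N), ((g • n : N) : L ≃ₐ[k] L) = g * n * g⁻¹)
    [FiniteDimensional k L] [IsGalois k L] (F : IntermediateField k L) (x : H) {t : L}
    (ht : t ∈ F) : convolutionAction α x t ∈ F := by
  rw [← IsGalois.fixedField_fixingSubgroup F, IntermediateField.mem_fixedField_iff]
  intro g hg
  rw [convolutionAction_apply, map_sum, ← Equiv.sum_comp (MulAction.toPerm g)
    (fun n : N => α x n * (n : L ≃ₐ[k] L)⁻¹ t)]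
  refine Finset.sum_congr rfl fun n _ => ?_
  rw [map_mul, ← hα.apply_smul]
  have hgt : g⁻¹ t = t :=
    (IntermediateField.mem_fixingSubgroup_iff F _).1 (F.fixingSubgroup.inv_mem hg) t ht
  simp only [MulAction.toPerm_apply, hconj, mul_inv_rev, inv_inv, AlgEquiv.mul_apply, hgt]

variable [FiniteDimensional k L] [IsGalois k L]

/-- The action of `H` on an intermediate field by convolution. -/
noncomputable def convolutionAlgHom (hα : IsConvolutionModel α)
    (hconj : ∀ (g : L ≃ₐ[k] L) (n : N), ((g • n : N) : L ≃ₐ[k] L) = g * n * g⁻¹)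
    (F : IntermediateField k L) : H →ₐ[k] Module.End k F :=
  AlgHom.ofLinearMap
    { toFun := fun x => (convolutionAction α x).restrict (p := F.toSubmodule)
        (q := F.toSubmodule) fun _ ht =>
          convolutionAction_mem hα.toIsEquivariantModel hconj F x ht
      map_add' := fun x y => by
        ext t
        simp [convolutionAction_apply, add_mul, Finset.sum_add_distrib]
      map_smul' := fun c x => by
        ext t
        simp [convolutionAction_apply, Finset.smul_sum] }
    (by ext t; exact convolutionAction_one hα _)
    (fun x y => by ext t; exact convolutionAction_mul hα hconj x y _)

theorem coe_convolutionAlgHom_apply (hα : IsConvolutionModel α)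
    (hconj : ∀ (g : L ≃ₐ[k] L) (n : N), ((g • n : N) : L ≃ₐ[k] L) = g * n * g⁻¹)
    (F : IntermediateField k L) (x : H) (t : F) :
    (convolutionAlgHom hα hconj F x t : L) = ∑ n : N, α x n * (n : L ≃ₐ[k] L)⁻¹ t :=
  convolutionAction_apply α x t

/-- Since `N` meets `Gal(L/F)` trivially, the elements `n⁻¹` restrict to distinct embeddings of `F`,
which are independent over `L`. With the independence of the descended basis of `H` this gives
injectivity, and `[F : k] = |N| = dim H` does the rest. -/
theorem bijective_hopfGaloisMap_convolution (hα : IsConvolutionModel α)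
    (hconj : ∀ (g : L ≃ₐ[k] L) (n : N), ((g • n : N) : L ≃ₐ[k] L) = g * n * g⁻¹)
    (F : IntermediateField k L) (hc : N.IsComplement' F.fixingSubgroup) :
    Function.Bijective (hopfGaloisMap k F H (convolutionAlgHom hα hconj F)) := by
  obtain ⟨r, c, hr, hc'⟩ := hα.toIsEquivariantModel.exists_basis
  have hF : Module.finrank k F = Nat.card N := by
    rw [IntermediateField.finrank_eq_fixingSubgroup_index, hc.index_eq_card]
  have hH : Module.finrank k H = Nat.card N := by
    rw [Module.finrank_eq_card_basis c, Fintype.card_fin, hr]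
  have := Module.Basis.finiteDimensional_of_finite c
  have hli : LinearIndependent L fun n : N => fun t : F => (n : L ≃ₐ[k] L)⁻¹ (t : L) := by
    refine (linearIndependent_monoidHom F L).comp (fun n : N =>
      ((((n : L ≃ₐ[k] L)⁻¹ : L ≃ₐ[k] L) : L →ₐ[k] L).comp F.val : F →* L)) ?_
    intro n m h
    have h1 : (n : L ≃ₐ[k] L) * (m : L ≃ₐ[k] L)⁻¹ ∈ F.fixingSubgroup := by
      rw [IntermediateField.mem_fixingSubgroup_iff]
      intro t ht
      have h2 : (n : L ≃ₐ[k] L)⁻¹ t = (m : L ≃ₐ[k] L)⁻¹ t := DFunLike.congr_fun h (⟨t, ht⟩ : F)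
      rw [AlgEquiv.mul_apply, ← h2, ← AlgEquiv.mul_apply, mul_inv_cancel, AlgEquiv.one_apply]
    have h3 := Subgroup.disjoint_def.1 hc.disjoint (N.mul_mem n.2 (N.inv_mem m.2)) h1
    exact Subtype.ext (mul_inv_eq_one.1 h3)
  have hinj : Function.Injective (hopfGaloisMap k F H (convolutionAlgHom hα hconj F)) := by
    rw [injective_iff_map_eq_zero]
    intro z hz
    let e := TensorProduct.equivFinsuppOfBasisRight (M := F) c
    obtain ⟨s, rfl⟩ := e.symm.surjective z
    suffices h : ∀ i, s i = 0 by
      rw [show s = 0 from Finsupp.ext h, map_zero]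
    have hsum : ∀ t : F, ∑ n : N, (∑ i, (s i : L) * α (c i) n) * (n : L ≃ₐ[k] L)⁻¹ (t : L) = 0 := by
      intro t
      have h1 := congrArg (algebraMap F L) (LinearMap.congr_fun hz t)
      simp only [e, TensorProduct.equivFinsuppOfBasisRight_symm_apply] at h1
      rw [Finsupp.sum_fintype _ _ (by simp)] at h1
      simp only [hopfGaloisMap, map_sum, TensorProduct.lift.tmul, LinearMap.sum_apply,
        LinearMap.compl₁₂_apply, LinearMap.mul_apply', Module.End.mul_apply, map_mul,
        AlgHom.toLinearMap_apply, IntermediateField.algebraMap_apply,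
        coe_convolutionAlgHom_apply, LinearMap.zero_apply, map_zero] at h1
      rw [← h1]
      simp only [Finset.sum_mul, Finset.mul_sum]
      rw [Finset.sum_comm]
      exact Finset.sum_congr rfl fun i _ => Finset.sum_congr rfl fun n _ => by ring
    have h2 : ∀ n, ∑ i, (s i : L) * α (c i) n = 0 := by
      apply Fintype.linearIndependent_iff.1 hli
      funext t
      rw [Finset.sum_apply, Pi.zero_apply, ← hsum t]
      rfl
    intro i
    have h3 : ∀ i, (s i : L) = 0 := by
      apply Fintype.linearIndependent_iff.1 hc'
      funext n
      rw [Finset.sum_apply, Pi.zero_apply, ← h2 n]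
      rfl
    exact Subtype.ext (h3 i)
  refine ⟨hinj, (LinearMap.injective_iff_surjective_of_finrank_eq_finrank ?_).1 hinj⟩
  rw [Module.finrank_tensorProduct, Module.finrank_linearMap, hH, hF]

/-- Comultiplication is supported on the diagonal, so the double sum collapses and the product rule
reduces to multiplicativity of each `n⁻¹`. -/
theorem isHopfGaloisAction_convolution (hα : IsConvolutionModel α)
    (hconj : ∀ (g : L ≃ₐ[k] L) (n : N), ((g • n : N) : L ≃ₐ[k] L) = g * n * g⁻¹)
    (F : IntermediateField k L) (hc : N.IsComplement' F.fixingSubgroup) :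
    @IsHopfGaloisAction k F H _ _ _ _ hα.hopfAlgebra (convolutionAlgHom hα hconj F) := by
  let := hα.hopfAlgebra
  refine ⟨fun x a b => ?_, fun x => ?_, bijective_hopfGaloisMap_convolution hα hconj F hc⟩
  · apply Subtype.ext
    have key : ∀ z : H ⊗[k] H, ((LinearMap.mul' k F (TensorProduct.homTensorHomMap (RingHom.id k)
        F F F F (TensorProduct.map (convolutionAlgHom hα hconj F).toLinearMap
          (convolutionAlgHom hα hconj F).toLinearMap z) (a ⊗ₜ[k] b)) : F) : L) =
        ∑ n : N, ∑ m : N, tensorEval α α z (n, m) *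
          ((n : L ≃ₐ[k] L)⁻¹ (a : L) * (m : L ≃ₐ[k] L)⁻¹ (b : L)) := by
      intro z
      induction z with
      | zero => simp
      | add y z hy hz =>
        simp only [map_add, LinearMap.add_apply, Pi.add_apply, add_mul, Finset.sum_add_distrib,
          ← hy, ← hz]
        rfl
      | tmul y z =>
        simp only [TensorProduct.map_tmul, TensorProduct.homTensorHomMap_apply,
          LinearMap.mul'_apply, AlgHom.toLinearMap_apply, IntermediateField.coe_mul,
          coe_convolutionAlgHom_apply, tensorEval_tmul, Finset.sum_mul_sum]
        exact Finset.sum_congr rfl fun n _ => Finset.sum_congr rfl fun m _ => by ring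
    rw [key, coe_convolutionAlgHom_apply]
    refine Finset.sum_congr rfl fun n _ => ?_
    have hcomul : ∀ m, tensorEval α α (Coalgebra.comul (R := k) x) (n, m) =
      if n = m then α x n else 0 := hα.tensorEval_comul x n
    simp [hcomul]
  · apply Subtype.ext
    rw [coe_convolutionAlgHom_apply]
    have hcounit : algebraMap k L (Coalgebra.counit (R := k) x) = ∑ n, α x n :=
      hα.algebraMap_counit x
    change _ = algebraMap k L (Coalgebra.counit (R := k) x)
    simp [hcounit]

end ConvolutionAction

/-- If `Gal(L/F)` has a normal complement in `Gal(L/k)`, then `F/k` is a Hopf Galois extension. -/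
theorem isHopfGalois_of_isComplement' {k : Type u} {L : Type v} [Field k] [Field L] [Algebra k L]
    [FiniteDimensional k L] [IsGalois k L] (F : IntermediateField k L) (N : Subgroup (L ≃ₐ[k] L))
    [N.Normal] (hc : N.IsComplement' F.fixingSubgroup) : IsHopfGalois k F := by
  classical
  refine ⟨inferInstance, ?_⟩
  have := Fintype.ofFinite N
  -- Normality lets the whole Galois group act on `N` by conjugation.
  let : MulDistribMulAction (L ≃ₐ[k] L) N := 
    MulDistribMulAction.compHom N (MulAut.conjNormal (H := N))
  have hconj : ∀ (g : L ≃ₐ[k] L) (n : N), ((g • n : N) : L ≃ₐ[k] L) = g * n * g⁻¹ :=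
    fun g n => MulAut.conjNormal_apply (H := N) g n
  have hα := equivariantGroupAlgebra.isConvolutionModel (k := k) (L := L) (N := N)
  obtain ⟨r, c, -, -⟩ := hα.toIsEquivariantModel.exists_basis
  exact ⟨equivariantGroupAlgebra k L N, inferInstance, hα.hopfAlgebra,
    convolutionAlgHom hα hconj F, Module.Basis.finiteDimensional_of_finite c, hα.isCocomm,
    isHopfGaloisAction_convolution hα hconj F hc⟩

/-! ### Normal complements and regular permutation groups -/

section AlmostClassical

/-- The image of a normal complement `N` of `G'` in `Sym(G/G')` is regular. -/
theorem isRegularPermGroup_map_toPermHom {G : Type*} [Group G] (N G' : Subgroup G) [N.Normal]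
    (hc : N.IsComplement' G') :
    IsRegularPermGroup (N.map (MulAction.toPermHom G (G ⧸ G'))) := by
  intro x y
  obtain ⟨a, rfl⟩ := QuotientGroup.mk_surjective x
  obtain ⟨b, rfl⟩ := QuotientGroup.mk_surjective y
  -- With `a⁻¹ b = n g`, the element `a n a⁻¹` lies in `N` by normality and carries the coset of `a`
  -- to that of `b`.
  obtain ⟨⟨n, g⟩, hng⟩ := hc.2 (a⁻¹ * b)
  have hng' : (n : G) * g = a⁻¹ * b := hng
  refine ⟨MulAction.toPermHom G (G ⧸ G') (a * n * a⁻¹), ⟨⟨_, Subgroup.Normal.conj_mem ‹_› _ n.2 a,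
    rfl⟩, ?_⟩, ?_⟩
  · change (((a * n * a⁻¹) * a : G) : G ⧸ G') = b
    rw [QuotientGroup.eq, inv_mul_cancel_right]
    have : (a * n)⁻¹ * b = g := by
      rw [mul_inv_rev, mul_assoc, ← hng', inv_mul_cancel_left]
    rw [this]
    exact g.2
  · rintro _ ⟨⟨m, hm, rfl⟩, hmb⟩
    have hmb' : ((m * a : G) : G ⧸ G') = b := hmb
    rw [QuotientGroup.eq] at hmb'
    congr 1
    have h1 : (n : G)⁻¹ * (a⁻¹ * m * a) ∈ N :=
      N.mul_mem (N.inv_mem n.2) (by simpa using Subgroup.Normal.conj_mem ‹N.Normal› m hm a⁻¹)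
    have h2 : (n : G)⁻¹ * (a⁻¹ * m * a) ∈ G' := by
      have h3 : (n : G)⁻¹ * (a⁻¹ * m * a) = g * ((m * a)⁻¹ * b)⁻¹ := by
        have : (n : G)⁻¹ = g * (a⁻¹ * b)⁻¹ := by rw [← hng']; group
        rw [this]; group
      rw [h3]
      exact G'.mul_mem g.2 (G'.inv_mem hmb')
    have h4 := inv_mul_eq_one.1 (Subgroup.disjoint_def.1 hc.disjoint h1 h2)
    rw [h4]; group

/-- If `Gal(L/F)` has a normal complement in `Gal(L/k)`, where `L` is the Galois closure of `F/k`,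
then `F/k` is almost classically Galois. -/
theorem isAlmostClassicallyGalois_of_isComplement' {k : Type u} {L : Type v} [Field k] [Field L]
    [Algebra k L] [FiniteDimensional k L] [IsGalois k L] (F : IntermediateField k L)
    (hF : IsNormalClosure k F L) (N : Subgroup (L ≃ₐ[k] L)) [N.Normal]
    (hc : N.IsComplement' F.fixingSubgroup) : IsAlmostClassicallyGalois k F := by
  refine ⟨inferInstance, inferInstance, L, inferInstance, inferInstance, inferInstance,
    inferInstance, hF, N.map (MulAction.toPermHom _ _), ?_, ?_, ?_⟩
  · apply isRegularPermGroup_map_toPermHom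
    have : galSubgroup k F L = F.fixingSubgroup := by
      rw [galSubgroup]
      congr 1
      exact F.fieldRange_val
    rwa [this]
  · have h := Subgroup.le_normalizer_map (H := N) (MulAction.toPermHom (L ≃ₐ[k] L)
      ((L ≃ₐ[k] L) ⧸ galSubgroup k F L))
    rwa [Subgroup.normalizer_eq_top, ← MonoidHom.range_eq_map] at h
  · rintro _ ⟨n, -, rfl⟩
    exact ⟨n, rfl⟩

end AlmostClassical

/-! ### Galois closures and the permutation of embeddings -/

section GaloisClosure

variable {k : Type u} {L : Type v} [Field k] [Field L] [Algebra k L]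

/-- The Galois closure of a finite separable extension is finite and Galois. -/
theorem IsNormalClosure.finiteDimensional_and_isGalois (K : IntermediateField k L)
    [FiniteDimensional k K] [Algebra.IsSeparable k K] (hL : IsNormalClosure k K L) :
    FiniteDimensional k L ∧ IsGalois k L := by
  have htop := (Algebra.IsAlgebraic.isNormalClosure_iff.1 hL).2
  have hnormal := hL.normal
  have hfin : FiniteDimensional k L := by
    have h : FiniteDimensional k (IntermediateField.normalClosure k K L) := inferInstance
    rw [htop] at h
    exact Module.Finite.equiv (IntermediateField.topEquiv (F := k) (E := L)).toLinearEquiv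
  have hsep : Algebra.IsSeparable k L := by
    rw [← separableClosure.eq_top_iff, ← top_le_iff, ← htop, normalClosure_le_iff]
    rintro f _ ⟨x, rfl⟩
    rw [mem_separableClosure_iff]
    exact (Algebra.IsSeparable.isSeparable k x).map f f.injective
  exact ⟨hfin, ⟨⟩⟩

theorem IsNormalClosure.of_le [FiniteDimensional k L] {K F : IntermediateField k L}
    (hL : IsNormalClosure k K L) (hKF : K ≤ F) : IsNormalClosure k F L := by
  have hnormal := hL.normal
  refine Algebra.IsAlgebraic.isNormalClosure_iff.2 ⟨fun x => ?_, ?_⟩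
  · rw [← minpoly.algebraMap_eq (algebraMap F L).injective x]
    exact hnormal.splits _
  · rw [← top_le_iff, ← (Algebra.IsAlgebraic.isNormalClosure_iff.1 hL).2]
    exact IntermediateField.normalClosure_mono K F hKF

/-- The images of the embeddings generate `L`, so fixing all of them pointwise means fixing `L`. -/
theorem IsNormalClosure.eq_one_of_comp_eq [FiniteDimensional k L] {F : IntermediateField k L}
    (hL : IsNormalClosure k F L) (σ : L ≃ₐ[k] L)
    (h : ∀ x : F →ₐ[k] L, (σ : L →ₐ[k] L).comp x = x) : σ = 1 := by
  have h1 : ⊤ ≤ IntermediateField.fixedField (Subgroup.zpowers σ) := by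
    rw [← (Algebra.IsAlgebraic.isNormalClosure_iff.1 hL).2, normalClosure_le_iff]
    intro x
    rw [IntermediateField.le_iff_le, Subgroup.zpowers_le, IntermediateField.mem_fixingSubgroup_iff]
    rintro _ ⟨t, rfl⟩
    exact DFunLike.congr_fun (h x) t
  rw [IntermediateField.le_iff_le, Subgroup.zpowers_le, IntermediateField.fixingSubgroup_top] at h1
  exact Subgroup.mem_bot.1 h1

theorem card_algHom_eq_finrank [FiniteDimensional k L] [IsGalois k L] (F : IntermediateField k L) :
    Nat.card (F →ₐ[k] L) = Module.finrank k F := by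
  rw [Nat.card_eq_fintype_card, AlgHom.card_of_splits]
  intro x
  rw [← minpoly.algebraMap_eq (algebraMap F L).injective x]
  exact Normal.splits inferInstance _

variable (k L) in
/-- The permutation representation of `Gal(L/k)` on the embeddings of `F` into `L`. -/
def galEmbeddingHom (F : Type*) [Field F] [Algebra k F] :
    (L ≃ₐ[k] L) →* Equiv.Perm (F →ₐ[k] L) where
  toFun σ :=
    { toFun := fun x => (σ : L →ₐ[k] L).comp x
      invFun := fun x => (σ.symm : L →ₐ[k] L).comp x
      left_inv := fun x => by ext; simp
      right_inv := fun x => by ext; simp }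
  map_one' := rfl
  map_mul' _ _ := rfl

theorem galEmbeddingHom_injective [FiniteDimensional k L] {F : IntermediateField k L}
    (hL : IsNormalClosure k F L) : Function.Injective (galEmbeddingHom k L F) := by
  rw [injective_iff_map_eq_one]
  exact fun σ hσ => hL.eq_one_of_comp_eq σ fun x => DFunLike.congr_fun hσ x

theorem mem_fixingSubgroup_iff_galEmbeddingHom (F : IntermediateField k L) (σ : L ≃ₐ[k] L) :
    σ ∈ F.fixingSubgroup ↔ galEmbeddingHom k L F σ F.val = F.val := by
  rw [IntermediateField.mem_fixingSubgroup_iff]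
  constructor
  · intro h
    ext t
    exact h t t.2
  · intro h t ht
    exact DFunLike.congr_fun h (⟨t, ht⟩ : F)

end GaloisClosure

/-! ### Extensions of degree five -/

section DegreeFive

variable {k : Type u} {L : Type v} [Field k] [Field L] [Algebra k L] [FiniteDimensional k L]
  [IsGalois k L]

/-- An extension of degree `5` for which the Galois group of the Galois closure has order dividing
`120` and a normal subgroup of order `5` is Hopf Galois. -/
theorem isHopfGalois_of_normal_of_card_eq_five (K : IntermediateField k L)
    (hdeg : Module.finrank k K = 5) (h120 : Nat.card (L ≃ₐ[k] L) ∣ 120)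
    (P : Subgroup (L ≃ₐ[k] L)) (hPn : P.Normal) (hP : Nat.card P = 5) : IsHopfGalois k K := by
  have h1 := K.fixingSubgroup.card_mul_index
  rw [← IntermediateField.finrank_eq_fixingSubgroup_index, hdeg] at h1
  apply isHopfGalois_of_isComplement' K P
  apply Subgroup.isComplement'_of_coprime
  · rw [hP, ← h1, mul_comm]
  -- If 5 divided `|Gal(L/K)|`, then 25 would divide the group order, hence 120.
  · rw [hP, Nat.Prime.coprime_iff_not_dvd (by norm_num)]
    rintro ⟨m, hm⟩
    rw [← h1, hm] at h120
    have : 25 ∣ 120 := Dvd.dvd.trans ⟨m, by ring⟩ h120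
    omega

theorem card_eq_sixty_of_mulEquiv {G : Type*} [Group G] (e : G ≃* alternatingGroup (Fin 5)) :
    Nat.card G = 60 := by
  rw [Nat.card_congr e.toEquiv, nat_card_alternatingGroup_fin_five]

theorem card_eq_of_mulEquiv_perm {G : Type*} [Group G] (e : G ≃* Equiv.Perm (Fin 5)) :
    Nat.card G = 120 := by
  rw [Nat.card_congr e.toEquiv, Nat.card_perm]; simp [Nat.factorial]

theorem isHopfGalois_top : IsHopfGalois k (⊤ : IntermediateField k L) := by
  apply isHopfGalois_of_isComplement' ⊤ ⊤
  rw [IntermediateField.fixingSubgroup_top]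
  exact Subgroup.isComplement'_top_bot

/-- If the Galois group of the Galois closure of `K/k` acts on the five embeddings of `K` as `S₅`,
then there is a field of degree `60` whose Galois group has a normal complement. -/
theorem exists_intermediateField_isComplement' (K : IntermediateField k L)
    (e : (K →ₐ[k] L) ≃ Fin 5) (f : (L ≃ₐ[k] L) →* Equiv.Perm (Fin 5))
    (hf : Function.Bijective f)
    (hfe : ∀ σ x, f σ (e x) = e (galEmbeddingHom k L K σ x)) :
    ∃ (F : IntermediateField k L) (N : Subgroup (L ≃ₐ[k] L)), K ≤ F ∧ N.Normal ∧
      N.IsComplement' F.fixingSubgroup ∧ Module.finrank k F = 60 := by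
  have hcard := card_eq_of_mulEquiv_perm (MulEquiv.ofBijective f hf)
  -- The transposition must avoid the point of the inclusion of `K`, so that its fixed field
  -- contains `K`.
  obtain ⟨i, j, hij, hi, hj⟩ : ∃ i j : Fin 5, i ≠ j ∧ e K.val ≠ i ∧ e K.val ≠ j := by
    generalize e K.val = a
    revert a
    decide
  obtain ⟨τ, hτ⟩ := hf.2 (Equiv.swap i j)
  have hτK : τ ∈ K.fixingSubgroup := by
    rw [mem_fixingSubgroup_iff_galEmbeddingHom]
    apply e.injective
    rw [← hfe, hτ, Equiv.swap_apply_of_ne_of_ne hi hj]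
  have hτ2 : τ ^ 2 = 1 := by
    apply hf.1
    rw [map_pow, hτ, sq, Equiv.swap_mul_self, map_one]
  have hτ1 : τ ≠ 1 := by
    rintro rfl
    rw [map_one] at hτ
    exact hij (Equiv.swap_eq_one_iff.1 hτ.symm)
  have hZ : Nat.card (Subgroup.zpowers τ) = 2 := by
    rw [Nat.card_zpowers]
    exact orderOf_eq_prime hτ2 hτ1
  have hfix : (IntermediateField.fixedField (Subgroup.zpowers τ)).fixingSubgroup =
    Subgroup.zpowers τ := IntermediateField.fixingSubgroup_fixedField _
  refine ⟨IntermediateField.fixedField (Subgroup.zpowers τ), (alternatingGroup (Fin 5)).comap f,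
    ?_, inferInstance, ?_, ?_⟩
  · rwa [IntermediateField.le_iff_le, Subgroup.zpowers_le]
  · rw [hfix]
    apply Subgroup.isComplement'_of_card_mul_and_disjoint
    · have h1 := ((alternatingGroup (Fin 5)).comap f).card_mul_index
      rw [Subgroup.index_comap_of_surjective _ hf.2, alternatingGroup.index_eq_two] at h1
      rw [hZ, h1]
    · rw [Subgroup.disjoint_def]
      rintro x hx hx'
      obtain ⟨m, rfl⟩ := Subgroup.mem_zpowers_iff.1 hx'
      -- Even powers of `τ` are trivial; odd powers equal `τ`, which maps to an odd permutation and
      -- so is not in the preimage of `A₅`.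
      rcases Int.even_or_odd' m with ⟨r, rfl | rfl⟩
      · rw [zpow_mul]
        norm_cast
        rw [hτ2, one_zpow]
      · rw [zpow_add, zpow_mul, zpow_one] at hx
        norm_cast at hx
        rw [hτ2, one_zpow, one_mul, Subgroup.mem_comap, hτ,
          Equiv.Perm.mem_alternatingGroup, Equiv.Perm.sign_swap hij] at hx
        exact absurd hx (by decide)
  · rw [IntermediateField.finrank_eq_fixingSubgroup_index, hfix]
    have h1 := (Subgroup.zpowers τ).card_mul_index
    rw [hZ, hcard] at h1
    omega

/-- If `A₅` embeds in the Galois group of the Galois closure of `K/k`, then every Hopf Galois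
extension of `k` that contains `K` properly has degree at least `60`. -/
theorem sixty_le_finrank_of_isHopfGalois (K : IntermediateField k L) (hL : IsNormalClosure k K L)
    (hdeg : Module.finrank k K = 5) (hK : ¬ IsHopfGalois k K)
    (h120 : Nat.card (L ≃ₐ[k] L) ∣ 120)
    (f : alternatingGroup (Fin 5) →* (L ≃ₐ[k] L)) (hf : Function.Injective f)
    (F : IntermediateField k L) (hKF : K ≤ F) (hF : IsHopfGalois k F) :
    60 ≤ Module.finrank k F := by
  by_contra! hlt
  have h5 : 5 ∣ Module.finrank k F := hdeg ▸ IntermediateField.finrank_dvd_of_le_right hKF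
  have hd : Module.finrank k F ∣ 120 := by
    rw [IntermediateField.finrank_eq_fixingSubgroup_index]
    exact F.fixingSubgroup.index_dvd_card.trans h120
  have hne : Module.finrank k F ≠ 5 := by
    intro h
    apply hK
    rwa [IntermediateField.eq_of_le_of_finrank_eq hKF (hdeg.trans h.symm)]
  -- These are the multiples of 5 below 60 that divide 120, apart from 5 itself.
  have hmem : Module.finrank k F ∈ ({10, 15, 20, 30, 40} : Set ℕ) := by
    obtain ⟨c, hc⟩ := h5
    rw [hc] at hlt hd hne ⊢
    have hc' : c < 12 := by omega
    simp only [Set.mem_insert_iff, Set.mem_singleton_iff]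
    interval_cases c <;> omega
  rw [← card_algHom_eq_finrank] at hmem
  exact not_isHopfGalois_of_alternatingGroup (hL.of_le hKF).eq_one_of_comp_eq f hf hmem hF

end DegreeFive

theorem mainTheorem5 {k : Type u} {L : Type v} [Field k] [Field L] [Algebra k L]
    (K : IntermediateField k L) (hsep : Algebra.IsSeparable k K) (hL : IsNormalClosure k K L)
    (hdeg : Module.finrank k K = 5) (hK : ¬ IsHopfGalois k K) :
    (Nonempty ((L ≃ₐ[k] L) ≃* alternatingGroup (Fin 5)) ∨
      Nonempty ((L ≃ₐ[k] L) ≃* Equiv.Perm (Fin 5))) ∧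
    IsLeast {d : ℕ | ∃ F : IntermediateField k L,
      K ≤ F ∧ IsHopfGalois k F ∧ Module.finrank k F = d} 60 ∧
    (Nonempty ((L ≃ₐ[k] L) ≃* alternatingGroup (Fin 5)) →
      IsHopfGalois k (⊤ : IntermediateField k L) ∧
      Module.finrank k (⊤ : IntermediateField k L) = 60) ∧
    (Nonempty ((L ≃ₐ[k] L) ≃* Equiv.Perm (Fin 5)) →
      ∃ F : IntermediateField k L, K ≤ F ∧ IsHopfGalois k F ∧ IsAlmostClassicallyGalois k F ∧
        Module.finrank k F = 60) := by
  have : FiniteDimensional k K := FiniteDimensional.of_finrank_pos (by omega)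
  obtain ⟨_, _⟩ := hL.finiteDimensional_and_isGalois
  have hX : Nat.card (K →ₐ[k] L) = 5 := (card_algHom_eq_finrank K).trans hdeg
  let e : (K →ₐ[k] L) ≃ Fin 5 := Finite.equivFinOfCardEq hX
  let f : (L ≃ₐ[k] L) →* Equiv.Perm (Fin 5) :=
    e.permCongrHom.toMonoidHom.comp (galEmbeddingHom k L K)
  have hf : Function.Injective f := e.permCongrHom.injective.comp (galEmbeddingHom_injective hL)
  have hfe : ∀ σ x, f σ (e x) = e (galEmbeddingHom k L K σ x) := fun σ x => by
    simp [f, Equiv.permCongrHom]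
  have h120 := card_dvd_of_injective_perm_fin_five f hf
  have h5 : 5 ∣ Nat.card (L ≃ₐ[k] L) := by
    rw [← hdeg, IntermediateField.finrank_eq_fixingSubgroup_index]
    exact K.fixingSubgroup.index_dvd_card
  have hA : Nonempty ((L ≃ₐ[k] L) ≃* alternatingGroup (Fin 5)) →
      IsHopfGalois k (⊤ : IntermediateField k L) ∧
      Module.finrank k (⊤ : IntermediateField k L) = 60 := by
    rintro ⟨e'⟩
    refine ⟨isHopfGalois_top, ?_⟩
    rw [IntermediateField.finrank_top', ← IsGalois.card_aut_eq_finrank,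
      card_eq_sixty_of_mulEquiv e']
  have hS : Nonempty ((L ≃ₐ[k] L) ≃* Equiv.Perm (Fin 5)) →
      ∃ F : IntermediateField k L, K ≤ F ∧ IsHopfGalois k F ∧ IsAlmostClassicallyGalois k F ∧
        Module.finrank k F = 60 := by
    rintro ⟨e'⟩
    -- The given isomorphism is abstract, but it fixes the order, so the permutation representation
    -- on embeddings is itself onto `S₅`.
    have hbij : Function.Bijective f :=
      (Nat.bijective_iff_injective_and_card f).2 ⟨hf, Nat.card_congr e'.toEquiv⟩
    obtain ⟨F, N, hKF, hN, hc, h60⟩ := exists_intermediateField_isComplement' K e f hbij hfe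
    exact ⟨F, hKF, isHopfGalois_of_isComplement' F N hc,
      isAlmostClassicallyGalois_of_isComplement' F (hL.of_le hKF) N hc, h60⟩
  have hAS : Nonempty ((L ≃ₐ[k] L) ≃* alternatingGroup (Fin 5)) ∨
      Nonempty ((L ≃ₐ[k] L) ≃* Equiv.Perm (Fin 5)) := by
    rcases alternating_or_symmetric_or_normal_sylow f hf h5 with h | h | ⟨P, hPn, hP⟩
    · exact .inl h
    · exact .inr ⟨MulEquiv.ofBijective f h⟩
    · exact absurd (isHopfGalois_of_normal_of_card_eq_five K hdeg h120 P hPn hP) hK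
  refine ⟨hAS, ⟨?_, ?_⟩, hA, hS⟩
  · rcases hAS with h | h
    · exact ⟨⊤, le_top, hA h⟩
    · obtain ⟨F, hKF, hF, -, h60⟩ := hS h
      exact ⟨F, hKF, hF, h60⟩
  · rintro d ⟨F, hKF, hF, rfl⟩
    obtain ⟨g, hg⟩ : ∃ g : alternatingGroup (Fin 5) →* (L ≃ₐ[k] L), Function.Injective g := by
      rcases hAS with ⟨⟨e'⟩⟩ | ⟨⟨e'⟩⟩
      · exact ⟨e'.symm.toMonoidHom, e'.symm.injective⟩
      · exact ⟨e'.symm.toMonoidHom.comp (alternatingGroup (Fin 5)).subtype,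
          e'.symm.injective.comp Subtype.val_injective⟩
    exact sixty_le_finrank_of_isHopfGalois K hL hdeg hK h120 g hg F hKF hF
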